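/- Let $B$ be a (not necessarily unital or separable) simple and purely infinite $C^*$-algebra and let $\rho$ be a state on $B$ with GNS representation $\pi_\rho : B \to B(\mathcal H_\rho)$ and canonical cyclic vector $\xi_\rho$. Assume that $\rho$ is strongly faithful, i.e. $\rho$ is faithful on $B$ and $x \mapsto \langle x\xi_\rho,\xi_\rho\rangle$ is faithful on the von Neumann algebra $\pi_\rho(B)''$. (Purely infinite is meant in the sense of Kirchberg and Rørdam: $B$ has no characters, and $a \precsim b$ whenever $a,b\in B_+$ and $a$ lies in the closed two-sided ideal generated by $b$. Here, for positive elements $a,b$ of a $C^*$-algebra $A$, Cuntz subequivalence $a \precsim b$ in $A$ means that for every $\varepsilon>0$ there is $c \in A$ with $\|a - c^*bc\|<\varepsilon$.) Put $\|b\|_\rho = \rho(b^*b)^{1/2}$ and $\|b\|_{\rho,\#} = \tfrac12(\|b\|_\rho + \|b^*\|_\rho)$ for $b \in B$. Let $B_\infty = \ell^\infty(B)/\{(x_n)_n : \lim_{n\to\infty}\|x_n\| = 0\}$ and, for a free ultrafilter $\omega$ on $\mathbb N$, let $B_\omega = \ell^\infty(B)/\{(x_n)_n : \lim_{n\to\omega}\|x_n\|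 = 0\}$. Define $$J_{B,\rho} = \{(x_n)_n \in B_\infty : \lim_{n\to\infty}\|x_n\|_{\rho,\#} = 0\}, \qquad S_{B,\rho} = \{(x_n)_n \in B_\infty : (x_n)_n \text{ is Cauchy for } \|\cdot\|_{\rho,\#}\},$$ and define $J^{(\omega)}_{B,\rho} \subseteq S^{(\omega)}_{B,\rho} \subseteq B_\omega$ in the same way, with limits and the Cauchy condition taken along $\omega$. Then there are reduced state-kernel extensions (short exact sequences of $C^*$-algebras) $$0 \to J_{B,\rho} \to S_{B,\rho} \xrightarrow{q_B} \pi_\rho(B)'' \to 0, \qquad 0 \to J^{(\omega)}_{B,\rho} \to S^{(\omega)}_{B,\rho} \xrightarrow{q_B^{(\omega)}} \pi_\rho(B)'' \to 0,$$ in which the first maps are the inclusions, and $q_B$ and $q_B^{(\omega)}$ send $(x_n)_n$ to the strong-$*$ limit of $\pi_\rho(x_n)$ as $n\to\infty$, respectively as $n\to\omega$. Both extensions are purely large, for every free ultrafilter $\omega$ on $\mathbb N$: if $0 \to I \to E \to D \to 0$ denotes either of them, then $y \precsim x$ in $E$ for all $y \in I_+$ and all $x \in E_+ \setminus I$. -/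

import Mathlib

open Filter Topology
open scoped ENNReal ComplexOrder InnerProductSpace

noncomputable section

/-- The C⋆-algebra `ℓ^∞(B)` of norm-bounded sequences in `B`. -/
abbrev BoundedSeq (B : Type*) [NonUnitalCStarAlgebra B] : Type _ := lp (fun _ : ℕ => B) ∞

section SequenceAlgebra

variable {B : Type*} [NonUnitalCStarAlgebra B]

/-- The bounded sequences that tend to zero in norm along the filter `F`. -/
def nullSeq (B : Type*) [NonUnitalCStarAlgebra B] (F : Filter ℕ) :
    Submodule ℂ (BoundedSeq B) where
  carrier := {x | Tendsto (fun n => ‖x n‖) F (𝓝 0)}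
  zero_mem' := by simp [tendsto_const_nhds]
  add_mem' {x y} hx hy := by
    have h : Tendsto (fun n => ‖x n‖ + ‖y n‖) F (𝓝 0) := by simpa using hx.add hy
    exact squeeze_zero (fun n => norm_nonneg _) (fun n => norm_add_le (x n) (y n)) h
  smul_mem' c x hx := by
    have h : Tendsto (fun n => ‖c‖ * ‖x n‖) F (𝓝 0) := by simpa using hx.const_mul ‖c‖
    exact squeeze_zero (fun n => norm_nonneg _) (fun n => (norm_smul c (x n)).le) h

lemma mem_nullSeq {F : Filter ℕ} {x : BoundedSeq B} :
    x ∈ nullSeq B F ↔ Tendsto (fun n => ‖x n‖) F (𝓝 0) := Iff.rfl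

lemma boundedSeq_norm_le (x : BoundedSeq B) (n : ℕ) : ‖x n‖ ≤ ‖x‖ :=
  lp.norm_apply_le_norm ENNReal.top_ne_zero x n

instance (F : Filter ℕ) : IsClosed (nullSeq B F : Set (BoundedSeq B)) := by
  refine isClosed_of_closure_subset fun x hx => ?_
  rw [Metric.mem_closure_iff] at hx
  refine mem_nullSeq.2 (Metric.tendsto_nhds.2 fun ε hε => ?_)
  obtain ⟨y, hy, hxy⟩ := hx (ε / 2) (half_pos hε)
  filter_upwards [(Metric.tendsto_nhds.1 (mem_nullSeq.1 hy)) (ε / 2) (half_pos hε)] with n hn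
  have h1 : ‖x n - y n‖ ≤ ‖x - y‖ := boundedSeq_norm_le (x - y) n
  rw [dist_eq_norm] at hxy
  have h2 : ‖x n‖ ≤ ‖x n - y n‖ + ‖y n‖ := by simpa using norm_add_le (x n - y n) (y n)
  simp only [dist_zero_right, norm_norm] at hn ⊢
  linarith

lemma nullSeq_mul_left {F : Filter ℕ} (a : BoundedSeq B) {x : BoundedSeq B}
    (hx : x ∈ nullSeq B F) : a * x ∈ nullSeq B F := by
  have h : Tendsto (fun n => ‖a‖ * ‖x n‖) F (𝓝 0) := by
    simpa using (mem_nullSeq.1 hx).const_mul ‖a‖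
  refine squeeze_zero (fun n => norm_nonneg _) (fun n => ?_) h
  exact (norm_mul_le (a n) (x n)).trans (by gcongr; exact boundedSeq_norm_le a n)

lemma nullSeq_mul_right {F : Filter ℕ} (a : BoundedSeq B) {x : BoundedSeq B}
    (hx : x ∈ nullSeq B F) : x * a ∈ nullSeq B F := by
  have h : Tendsto (fun n => ‖x n‖ * ‖a‖) F (𝓝 0) := by
    simpa using (mem_nullSeq.1 hx).mul_const ‖a‖
  refine squeeze_zero (fun n => norm_nonneg _) (fun n => ?_) h
  exact (norm_mul_le (x n) (a n)).trans (by gcongr; exact boundedSeq_norm_le a n)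

lemma nullSeq_star {F : Filter ℕ} {x : BoundedSeq B}
    (hx : x ∈ nullSeq B F) : star x ∈ nullSeq B F := by
  simpa [mem_nullSeq] using hx

/-- The quotient `ℓ^∞(B) / c_F(B)` of the bounded sequences by those tending to zero in norm
along `F`, with the quotient norm. For `F = atTop` this is the sequence algebra `B_∞`, and for a
free ultrafilter `F = ω` it is the ultrapower `B_ω`. -/
def SeqAlg (B : Type*) [NonUnitalCStarAlgebra B] (F : Filter ℕ) : Type _ :=
  BoundedSeq B ⧸ nullSeq B F

namespace SeqAlg

variable {F : Filter ℕ}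

instance : NormedAddCommGroup (SeqAlg B F) :=
  inferInstanceAs (NormedAddCommGroup (BoundedSeq B ⧸ nullSeq B F))

instance : NormedSpace ℂ (SeqAlg B F) :=
  inferInstanceAs (NormedSpace ℂ (BoundedSeq B ⧸ nullSeq B F))

instance : CompleteSpace (SeqAlg B F) :=
  inferInstanceAs (CompleteSpace (BoundedSeq B ⧸ nullSeq B F))

/-- The class of a bounded sequence. -/
def mk (F : Filter ℕ) (x : BoundedSeq B) : SeqAlg B F := (nullSeq B F).mkQ x

lemma mk_surjective : Function.Surjective (mk F : BoundedSeq B → SeqAlg B F) :=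
  (nullSeq B F).mkQ_surjective

lemma mk_eq_mk {x y : BoundedSeq B} :
    mk F x = mk F y ↔ x - y ∈ nullSeq B F := Submodule.Quotient.eq _

lemma mk_add (x y : BoundedSeq B) : mk F (x + y) = mk F x + mk F y := rfl
lemma mk_sub (x y : BoundedSeq B) : mk F (x - y) = mk F x - mk F y := rfl
lemma mk_smul (c : ℂ) (x : BoundedSeq B) : mk F (c • x) = c • mk F x := rfl
lemma mk_zero : mk F (0 : BoundedSeq B) = 0 := rfl

lemma norm_mk_le (x : BoundedSeq B) : ‖mk F x‖ ≤ ‖x‖ :=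
  Submodule.Quotient.norm_mk_le (nullSeq B F) x

lemma exists_norm_lt (a : SeqAlg B F) {ε : ℝ} (hε : 0 < ε) :
    ∃ x : BoundedSeq B, mk F x = a ∧ ‖x‖ < ‖a‖ + ε :=
  Submodule.Quotient.norm_mk_lt (S := nullSeq B F) a hε

instance : Mul (SeqAlg B F) where
  mul := Quotient.map₂ (· * ·) (by
    intro x x' hx y y' hy
    have hx : x - x' ∈ nullSeq B F := (Submodule.quotientRel_def _).1 hx
    have hy : y - y' ∈ nullSeq B F := (Submodule.quotientRel_def _).1 hy
    refine (Submodule.quotientRel_def _).2 ?_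
    have h : x * y - x' * y' = x * (y - y') + (x - x') * y' := by
      rw [mul_sub, sub_mul]; abel
    rw [h]
    exact add_mem (nullSeq_mul_left _ hy) (nullSeq_mul_right _ hx))

lemma mk_mul (x y : BoundedSeq B) : mk F (x * y) = mk F x * mk F y := rfl

instance : Star (SeqAlg B F) where
  star := Quotient.map star (by
    intro x x' hx
    have hx : x - x' ∈ nullSeq B F := (Submodule.quotientRel_def _).1 hx
    refine (Submodule.quotientRel_def _).2 ?_
    rw [← star_sub]
    exact nullSeq_star hx)

lemma mk_star (x : BoundedSeq B) : mk F (star x) = star (mk F x) := rfl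

instance : NonUnitalNormedRing (SeqAlg B F) where
  __ := (inferInstance : NormedAddCommGroup (SeqAlg B F))
  left_distrib a b c := by
    obtain ⟨x, rfl⟩ := mk_surjective a
    obtain ⟨y, rfl⟩ := mk_surjective b
    obtain ⟨z, rfl⟩ := mk_surjective c
    simp only [← mk_mul, ← mk_add, mul_add]
  right_distrib a b c := by
    obtain ⟨x, rfl⟩ := mk_surjective a
    obtain ⟨y, rfl⟩ := mk_surjective b
    obtain ⟨z, rfl⟩ := mk_surjective c
    simp only [← mk_mul, ← mk_add, add_mul]
  zero_mul a := by
    obtain ⟨x, rfl⟩ := mk_surjective a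
    rw [← mk_zero, ← mk_mul, zero_mul]
  mul_zero a := by
    obtain ⟨x, rfl⟩ := mk_surjective a
    rw [← mk_zero, ← mk_mul, mul_zero]
  mul_assoc a b c := by
    obtain ⟨x, rfl⟩ := mk_surjective a
    obtain ⟨y, rfl⟩ := mk_surjective b
    obtain ⟨z, rfl⟩ := mk_surjective c
    simp only [← mk_mul, mul_assoc]
  norm_mul_le a b := by
    refine le_of_forall_pos_le_add fun ε hε => ?_
    have hc : Tendsto (fun t : ℝ => (‖a‖ + t) * (‖b‖ + t)) (𝓝[>] 0) (𝓝 (‖a‖ * ‖b‖)) := by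
      have : Continuous fun t : ℝ => (‖a‖ + t) * (‖b‖ + t) := by fun_prop
      simpa using (this.tendsto 0).mono_left nhdsWithin_le_nhds
    obtain ⟨t, ht, ht0⟩ := ((hc.eventually (gt_mem_nhds (lt_add_of_pos_right _ hε))).and
      self_mem_nhdsWithin).exists
    obtain ⟨x, hx, hx'⟩ := exists_norm_lt a ht0
    obtain ⟨y, hy, hy'⟩ := exists_norm_lt b ht0
    rw [← hx, ← hy, ← mk_mul, hx, hy]
    calc _ ≤ ‖x * y‖ := norm_mk_le _
      _ ≤ ‖x‖ * ‖y‖ := norm_mul_le _ _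
      _ ≤ (‖a‖ + t) * (‖b‖ + t) := by gcongr
      _ ≤ _ := ht.le

instance : StarRing (SeqAlg B F) where
  star_involutive a := by
    obtain ⟨x, rfl⟩ := mk_surjective a
    simp only [← mk_star, star_star]
  star_mul a b := by
    obtain ⟨x, rfl⟩ := mk_surjective a
    obtain ⟨y, rfl⟩ := mk_surjective b
    simp only [← mk_star, ← mk_mul, star_mul]
  star_add a b := by
    obtain ⟨x, rfl⟩ := mk_surjective a
    obtain ⟨y, rfl⟩ := mk_surjective b
    simp only [← mk_star, ← mk_add, star_add]

/-- The norm of a class is bounded by any eventual bound on a representative. -/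
lemma norm_mk_le_of_eventually {x : BoundedSeq B} {r : ℝ} (hr : 0 ≤ r)
    (h : ∀ᶠ n in F, ‖x n‖ ≤ r) : ‖mk F x‖ ≤ r := by
  classical
  let s : Set ℕ := {n | ‖x n‖ ≤ r}
  have hbd (n : ℕ) : ‖s.indicator x n‖ ≤ r := by
    by_cases hn : n ∈ s
    · rw [Set.indicator_of_mem hn]; exact hn
    · rw [Set.indicator_of_notMem hn, norm_zero]; exact hr
  let y : BoundedSeq B := ⟨s.indicator x, memℓp_infty ⟨r, by rintro _ ⟨n, rfl⟩; exact hbd n⟩⟩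
  have hxy : mk F x = mk F y := by
    refine mk_eq_mk.2 (mem_nullSeq.2 (tendsto_const_nhds.congr' ?_))
    filter_upwards [h] with n hn
    have hn : n ∈ s := hn
    have : y n = x n := Set.indicator_of_mem hn _
    simp [this]
  rw [hxy]
  exact (norm_mk_le y).trans (lp.norm_le_of_forall_le hr hbd)

instance : CStarRing (SeqAlg B F) where
  norm_mul_self_le a := by
    obtain ⟨x, rfl⟩ := mk_surjective a
    refine le_of_forall_pos_le_add fun ε hε => ?_
    obtain ⟨y, hy, hy'⟩ := exists_norm_lt (star (mk F x) * mk F x) (half_pos hε)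
    rw [← mk_star, ← mk_mul, mk_eq_mk] at hy
    set r := ‖star (mk F x) * mk F x‖ + ε with hr
    have hr0 : 0 ≤ r := by positivity
    have h : ‖mk F x‖ ≤ √r := by
      refine norm_mk_le_of_eventually (Real.sqrt_nonneg _) ?_
      filter_upwards [(Metric.tendsto_nhds.1 (mem_nullSeq.1 hy)) (ε / 2) (half_pos hε)] with n hn
      refine Real.le_sqrt_of_sq_le ?_
      simp only [dist_zero_right, norm_norm] at hn
      have h1 : ‖x n‖ ^ 2 = ‖star (x n) * x n‖ := by rw [CStarRing.norm_star_mul_self, sq]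
      have h2 : (y - star x * x) n = y n - star (x n) * x n := rfl
      rw [h2] at hn
      have h3 : ‖star (x n) * x n‖ ≤ ‖y n‖ + ‖y n - star (x n) * x n‖ := by
        simpa using norm_sub_le (y n) (y n - star (x n) * x n)
      have h4 := boundedSeq_norm_le y n
      linarith
    calc ‖mk F x‖ * ‖mk F x‖ ≤ √r * √r := by gcongr
      _ = r := Real.mul_self_sqrt hr0

instance : NonUnitalCStarAlgebra (SeqAlg B F) where
  smul_assoc c a b := by
    obtain ⟨x, rfl⟩ := mk_surjective a
    obtain ⟨y, rfl⟩ := mk_surjective b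
    simp only [smul_eq_mul, ← mk_mul, ← mk_smul, smul_mul_assoc]
  smul_comm c a b := by
    obtain ⟨x, rfl⟩ := mk_surjective a
    obtain ⟨y, rfl⟩ := mk_surjective b
    simp only [smul_eq_mul, ← mk_mul, ← mk_smul, mul_smul_comm]
  star_smul c a := by
    obtain ⟨x, rfl⟩ := mk_surjective a
    simp only [← mk_star, ← mk_smul, star_smul]

end SeqAlg

end SequenceAlgebra



section States

set_option linter.unusedSectionVars false

variable {B : Type*} [NonUnitalCStarAlgebra B] [PartialOrder B] [StarOrderedRing B]

/-- A positive linear functional is a state if it has norm one. -/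
def IsState (ρ : B →ₚ[ℂ] ℂ) : Prop :=
  IsLUB {r : ℝ | ∃ b : B, ‖b‖ ≤ 1 ∧ r = ‖ρ b‖} 1

/-- The seminorm `‖b‖_ρ = ρ(b* b)^{1/2}`. -/
def rhoNorm (ρ : B →ₚ[ℂ] ℂ) (b : B) : ℝ := √(ρ (star b * b)).re

/-- The seminorm `‖b‖_{ρ,#} = (‖b‖_ρ + ‖b*‖_ρ) / 2`. -/
def rhoSharpNorm (ρ : B →ₚ[ℂ] ℂ) (b : B) : ℝ := (1 / 2) * (rhoNorm ρ b + rhoNorm ρ (star b))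

/-- The vector in the GNS Hilbert space given by an algebra element. -/
def gnsClass (ρ : B →ₚ[ℂ] ℂ) (b : B) : ρ.GNS := (ρ.toPreGNS b : ρ.GNS)

lemma norm_gnsClass (ρ : B →ₚ[ℂ] ℂ) (b : B) : ‖gnsClass ρ b‖ = rhoNorm ρ b :=
  UniformSpace.Completion.norm_coe _

lemma gns_apply_gnsClass (ρ : B →ₚ[ℂ] ℂ) (a b : B) :
    ρ.gnsNonUnitalStarAlgHom a (gnsClass ρ b) = gnsClass ρ (a * b) :=
  PositiveLinearMap.gnsNonUnitalStarAlgHom_apply_coe ρ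

lemma inner_gnsClass (ρ : B →ₚ[ℂ] ℂ) (a b : B) :
    ⟪gnsClass ρ a, gnsClass ρ b⟫_ℂ = ρ (star a * b) :=
  UniformSpace.Completion.inner_coe _ _

lemma gnsClass_sub (ρ : B →ₚ[ℂ] ℂ) (a b : B) :
    gnsClass ρ (a - b) = gnsClass ρ a - gnsClass ρ b := by
  simp [gnsClass, UniformSpace.Completion.coe_sub]

lemma dense_gnsClass (ρ : B →ₚ[ℂ] ℂ) : DenseRange (gnsClass ρ) :=
  UniformSpace.Completion.denseRange_coe (α := ρ.PreGNS)

lemma rhoNorm_nonneg (ρ : B →ₚ[ℂ] ℂ) (b : B) : 0 ≤ rhoNorm ρ b := Real.sqrt_nonneg _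

lemma gns_ext {ρ : B →ₚ[ℂ] ℂ} {v w : ρ.GNS}
    (h : ∀ a, ⟪gnsClass ρ a, v⟫_ℂ = ⟪gnsClass ρ a, w⟫_ℂ) : v = w := by
  refine ext_inner_left ℂ fun u => ?_
  have : (fun u => ⟪u, v⟫_ℂ) = fun u => ⟪u, w⟫_ℂ :=
    (dense_gnsClass ρ).equalizer (by fun_prop) (by fun_prop) (funext h)
  exact congrFun this u

lemma exists_gnsVector (ρ : B →ₚ[ℂ] ℂ) :
    ∃ ξ : ρ.GNS, ∀ b, ρ.gnsNonUnitalStarAlgHom b ξ = gnsClass ρ b := by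
  obtain ⟨C, hC⟩ := ρ.exists_norm_apply_le
  have hcont : Continuous ρ := map_continuous ρ
  have key (b : B) : ‖ρ b‖ ≤ √(C : ℝ) * ‖ρ.toPreGNS b‖ := by
    have hl := CStarAlgebra.increasingApproximateUnit B
    have h1 : Tendsto (fun e => ‖ρ (e * b)‖) (CStarAlgebra.approximateUnit B) (𝓝 ‖ρ b‖) :=
      ((hcont.tendsto b).comp (hl.tendsto_mul_right b)).norm
    refine le_of_tendsto h1 ?_
    filter_upwards [hl.eventually_norm, hl.eventually_star_eq] with e he hs
    have h2 : ρ (e * b) = ⟪ρ.toPreGNS e, ρ.toPreGNS b⟫_ℂ := by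
      rw [PositiveLinearMap.preGNS_inner_def]
      simp [hs]
    rw [h2]
    refine (norm_inner_le_norm _ _).trans ?_
    gcongr
    rw [PositiveLinearMap.preGNS_norm_def]
    refine Real.sqrt_le_sqrt ?_
    calc _ ≤ ‖ρ (star e * e)‖ := Complex.re_le_norm _
      _ ≤ C * ‖star e * e‖ := hC _
      _ ≤ C * 1 := by
        gcongr
        rw [CStarRing.norm_star_mul_self]
        nlinarith [norm_nonneg e]
      _ = C := mul_one _
  let f : ρ.PreGNS →L[ℂ] ℂ :=
    LinearMap.mkContinuous (ρ.toLinearMap ∘ₗ ρ.ofPreGNS.toLinearMap) (√(C : ℝ)) (fun x => key _)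
  let g : ρ.GNS →L[ℂ] ℂ := f.extend UniformSpace.Completion.toComplL
  have hg (b : B) : g (gnsClass ρ b) = ρ b := by
    have := ContinuousLinearMap.extend_eq f (e := UniformSpace.Completion.toComplL)
      (UniformSpace.Completion.denseRange_coe)
      (UniformSpace.Completion.isUniformInducing_coe _) (ρ.toPreGNS b)
    exact this
  refine ⟨(InnerProductSpace.toDual ℂ ρ.GNS).symm g, fun b => gns_ext fun a => ?_⟩
  rw [← ContinuousLinearMap.adjoint_inner_left, ← ContinuousLinearMap.star_eq_adjoint,
    ← map_star, gns_apply_gnsClass, ← inner_conj_symm, InnerProductSpace.toDual_symm_apply, hg,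
    inner_gnsClass, starRingEnd_apply, ← map_star]
  simp

/-- The canonical cyclic vector `ξ_ρ` of the GNS representation, the unique vector such that
`π_ρ(b) ξ_ρ` is the class of `b` for every `b`. -/
def gnsVector (ρ : B →ₚ[ℂ] ℂ) : ρ.GNS := (exists_gnsVector ρ).choose

lemma gns_apply_gnsVector (ρ : B →ₚ[ℂ] ℂ) (b : B) :
    ρ.gnsNonUnitalStarAlgHom b (gnsVector ρ) = gnsClass ρ b := (exists_gnsVector ρ).choose_spec b

lemma gnsVector_unique (ρ : B →ₚ[ℂ] ℂ) {ξ : ρ.GNS}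
    (h : ∀ b, ρ.gnsNonUnitalStarAlgHom b ξ = gnsClass ρ b) : ξ = gnsVector ρ := by
  refine gns_ext fun a => ?_
  rw [← gns_apply_gnsVector ρ a, ← ContinuousLinearMap.adjoint_inner_right,
    ← ContinuousLinearMap.adjoint_inner_right, ← ContinuousLinearMap.star_eq_adjoint, ← map_star,
    h, gns_apply_gnsVector]

lemma centralizer_range_star (ρ : B →ₚ[ℂ] ℂ) :
    star (Set.centralizer (Set.range ρ.gnsNonUnitalStarAlgHom)) =
      Set.centralizer (Set.range ρ.gnsNonUnitalStarAlgHom) := by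
  have h : star (Set.range ρ.gnsNonUnitalStarAlgHom) = Set.range ρ.gnsNonUnitalStarAlgHom := by
    ext T
    simp only [Set.mem_star, Set.mem_range]
    constructor <;> rintro ⟨b, hb⟩ <;> refine ⟨star b, ?_⟩
    · rw [map_star, hb, star_star]
    · rw [map_star, hb]
  rw [Set.star_centralizer, h]

/-- The von Neumann algebra generated by the GNS representation: the double commutant of the
range of `π_ρ`. -/
def gnsVN (ρ : B →ₚ[ℂ] ℂ) : VonNeumannAlgebra ρ.GNS where
  toStarSubalgebra := StarSubalgebra.centralizer ℂ
    (Set.centralizer (Set.range ρ.gnsNonUnitalStarAlgHom))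
  centralizer_centralizer' := by
    simp [centralizer_range_star, StarSubalgebra.coe_centralizer]

lemma coe_gnsVN (ρ : B →ₚ[ℂ] ℂ) : (gnsVN ρ : Set (ρ.GNS →L[ℂ] ρ.GNS)) =
    Set.centralizer (Set.centralizer (Set.range ρ.gnsNonUnitalStarAlgHom)) := by
  change Set.centralizer (_ ∪ star _) = _
  rw [centralizer_range_star, Set.union_self]

instance (ρ : B →ₚ[ℂ] ℂ) :
    IsClosed ((gnsVN ρ).toStarSubalgebra : Set (ρ.GNS →L[ℂ] ρ.GNS)) := by
  rw [VonNeumannAlgebra.coe_toStarSubalgebra, coe_gnsVN]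
  exact Set.isClosed_centralizer _

/-- The canonical extension `x ↦ ⟨x ξ_ρ, ξ_ρ⟩` of `ρ` to the bounded operators on the GNS space. -/
def gnsExt (ρ : B →ₚ[ℂ] ℂ) (T : ρ.GNS →L[ℂ] ρ.GNS) : ℂ := ⟪gnsVector ρ, T (gnsVector ρ)⟫_ℂ

/-- `ρ` is strongly faithful if it is faithful on `B` and its canonical extension is faithful on
the double commutant of `π_ρ(B)`. -/
structure IsStronglyFaithful (ρ : B →ₚ[ℂ] ℂ) : Prop where
  faithful : ∀ b : B, ρ (star b * b) = 0 → b = 0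
  faithful_ext : ∀ T ∈ gnsVN ρ, gnsExt ρ (star T * T) = 0 → T = 0

lemma gns_mem_gnsVN (ρ : B →ₚ[ℂ] ℂ) (b : B) : ρ.gnsNonUnitalStarAlgHom b ∈ gnsVN ρ := by
  rw [← SetLike.mem_coe, coe_gnsVN]
  exact Set.subset_centralizer_centralizer ⟨b, rfl⟩

/-- If `ρ` is strongly faithful, then `ξ_ρ` is cyclic for the commutant of `π_ρ(B)`. -/
lemma IsStronglyFaithful.exists_commutant {ρ : B →ₚ[ℂ] ℂ} (hρ : IsStronglyFaithful ρ)
    (η : ρ.GNS) {ε : ℝ} (hε : 0 < ε) :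
    ∃ T ∈ (gnsVN ρ).commutant, ‖η - T (gnsVector ρ)‖ < ε := by
  let K₀ : Submodule ℂ ρ.GNS := (Subalgebra.toSubmodule
    (gnsVN ρ).commutant.toStarSubalgebra.toSubalgebra).map
      (ContinuousLinearMap.apply ℂ ρ.GNS (gnsVector ρ)).toLinearMap
  let K := K₀.topologicalClosure
  have hK₀ (v : ρ.GNS) : v ∈ K₀ ↔ ∃ T ∈ (gnsVN ρ).commutant, T (gnsVector ρ) = v := Iff.rfl
  have : CompleteSpace K := K₀.isClosed_topologicalClosure.completeSpace_coe
  have hinv : ∀ y ∈ (gnsVN ρ).commutant, ∀ v ∈ K, y v ∈ K := by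
    intro y hy v hv
    refine map_mem_closure y.continuous hv fun w hw => ?_
    obtain ⟨T, hT, rfl⟩ := (hK₀ w).1 hw
    exact (hK₀ _).2 ⟨y * T, mul_mem hy hT, rfl⟩
  have hP : K.starProjection ∈ gnsVN ρ := by
    rw [VonNeumannAlgebra.IsStarProjection.mem_iff isStarProjection_starProjection]
    intro y hy
    rw [Submodule.range_starProjection]
    exact fun v hv => hinv y hy v hv
  have hξ : gnsVector ρ ∈ K :=
    K₀.le_topologicalClosure ((hK₀ _).2 ⟨1, one_mem _, rfl⟩)
  have h1 : 1 - K.starProjection = 0 := by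
    refine hρ.faithful_ext _ (sub_mem (one_mem _) hP) ?_
    have : (1 - K.starProjection) (gnsVector ρ) = 0 := by
      simp [Submodule.starProjection_eq_self_iff.2 hξ]
    rw [gnsExt, mul_apply_eq_comp, this, map_zero, inner_zero_right]
  have hη : η ∈ K := by
    rw [← Submodule.starProjection_eq_self_iff, ← sub_eq_zero.1 h1]
    rfl
  obtain ⟨w, hw, hd⟩ := Metric.mem_closure_iff.1 hη ε hε
  obtain ⟨T, hT, rfl⟩ := (hK₀ w).1 hw
  exact ⟨T, hT, by rwa [dist_eq_norm] at hd⟩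

lemma norm_gns_apply_le (ρ : B →ₚ[ℂ] ℂ) (b : B) (v : ρ.GNS) :
    ‖ρ.gnsNonUnitalStarAlgHom b v‖ ≤ ‖b‖ * ‖v‖ := by
  refine (ContinuousLinearMap.le_opNorm _ _).trans ?_
  gcongr
  exact NonUnitalStarAlgHom.norm_apply_le _ _

lemma norm_gns_gnsVector (ρ : B →ₚ[ℂ] ℂ) (b : B) :
    ‖ρ.gnsNonUnitalStarAlgHom b (gnsVector ρ)‖ = rhoNorm ρ b := by
  rw [gns_apply_gnsVector, norm_gnsClass]

lemma rhoNorm_zero (ρ : B →ₚ[ℂ] ℂ) : rhoNorm ρ 0 = 0 := by simp [rhoNorm]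

lemma rhoNorm_add_le (ρ : B →ₚ[ℂ] ℂ) (a b : B) :
    rhoNorm ρ (a + b) ≤ rhoNorm ρ a + rhoNorm ρ b := by
  simp only [← norm_gns_gnsVector, map_add, add_apply]
  exact norm_add_le _ _

lemma rhoNorm_smul (ρ : B →ₚ[ℂ] ℂ) (c : ℂ) (b : B) :
    rhoNorm ρ (c • b) = ‖c‖ * rhoNorm ρ b := by
  simp only [← norm_gns_gnsVector, map_smul, smul_apply, norm_smul]

lemma rhoNorm_mul_le (ρ : B →ₚ[ℂ] ℂ) (a b : B) : rhoNorm ρ (a * b) ≤ ‖a‖ * rhoNorm ρ b := by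
  simp only [← norm_gns_gnsVector, map_mul, mul_apply_eq_comp]
  exact norm_gns_apply_le _ _ _

lemma rhoNorm_le (ρ : B →ₚ[ℂ] ℂ) (b : B) : rhoNorm ρ b ≤ ‖gnsVector ρ‖ * ‖b‖ := by
  rw [← norm_gns_gnsVector, mul_comm]
  exact norm_gns_apply_le _ _ _

lemma rhoSharpNorm_nonneg (ρ : B →ₚ[ℂ] ℂ) (b : B) : 0 ≤ rhoSharpNorm ρ b := by
  have h1 := rhoNorm_nonneg ρ b
  have h2 := rhoNorm_nonneg ρ (star b)
  unfold rhoSharpNorm; linarith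

lemma rhoSharpNorm_star (ρ : B →ₚ[ℂ] ℂ) (b : B) : rhoSharpNorm ρ (star b) = rhoSharpNorm ρ b := by
  rw [rhoSharpNorm, rhoSharpNorm, star_star, add_comm]

lemma rhoSharpNorm_zero (ρ : B →ₚ[ℂ] ℂ) : rhoSharpNorm ρ 0 = 0 := by
  simp [rhoSharpNorm, rhoNorm_zero]

lemma rhoSharpNorm_add_le (ρ : B →ₚ[ℂ] ℂ) (a b : B) :
    rhoSharpNorm ρ (a + b) ≤ rhoSharpNorm ρ a + rhoSharpNorm ρ b := by
  have h1 := rhoNorm_add_le ρ a b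
  have h2 := rhoNorm_add_le ρ (star a) (star b)
  simp only [rhoSharpNorm, star_add]; linarith

lemma rhoSharpNorm_smul (ρ : B →ₚ[ℂ] ℂ) (c : ℂ) (b : B) :
    rhoSharpNorm ρ (c • b) = ‖c‖ * rhoSharpNorm ρ b := by
  simp only [rhoSharpNorm, star_smul, rhoNorm_smul, norm_star]; ring

lemma rhoSharpNorm_le (ρ : B →ₚ[ℂ] ℂ) (b : B) :
    rhoSharpNorm ρ b ≤ ‖gnsVector ρ‖ * ‖b‖ := by
  have h1 := rhoNorm_le ρ b
  have h2 := rhoNorm_le ρ (star b)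
  rw [norm_star] at h2
  unfold rhoSharpNorm; linarith

lemma rhoSharpNorm_mul_le (ρ : B →ₚ[ℂ] ℂ) (a b : B) :
    rhoSharpNorm ρ (a * b) ≤ ‖a‖ * rhoSharpNorm ρ b + ‖b‖ * rhoSharpNorm ρ a := by
  have h1 := rhoNorm_mul_le ρ a b
  have h2 := rhoNorm_mul_le ρ (star b) (star a)
  have h3 := mul_nonneg (norm_nonneg a) (rhoNorm_nonneg ρ (star b))
  have h4 := mul_nonneg (norm_nonneg b) (rhoNorm_nonneg ρ a)
  rw [norm_star] at h2
  simp only [rhoSharpNorm, star_mul]; linarith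

end States

section StateKernel

set_option linter.unusedSectionVars false

variable {B : Type*} [NonUnitalCStarAlgebra B] [PartialOrder B] [StarOrderedRing B]

/-- The sequence tends to zero in the `(ρ,#)`-norm along `F`. -/
def IsRhoSharpNull (ρ : B →ₚ[ℂ] ℂ) (F : Filter ℕ) (x : BoundedSeq B) : Prop :=
  Tendsto (fun n => rhoSharpNorm ρ (x n)) F (𝓝 0)

/-- The sequence is `(ρ,#)`-Cauchy along `F`: the quantities `‖x_n - x_m‖_{ρ,#}` tend to zero as
`n` and `m` tend to infinity along `F`. -/
def IsRhoSharpCauchy (ρ : B →ₚ[ℂ] ℂ) (F : Filter ℕ) (x : BoundedSeq B) : Prop :=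
  Tendsto (fun p : ℕ × ℕ => rhoSharpNorm ρ (x p.1 - x p.2)) (F ×ˢ F) (𝓝 0)

lemma isRhoSharpNull_of_mem_nullSeq (ρ : B →ₚ[ℂ] ℂ) {F : Filter ℕ} {x : BoundedSeq B}
    (hx : x ∈ nullSeq B F) : IsRhoSharpNull ρ F x := by
  have h : Tendsto (fun n => ‖gnsVector ρ‖ * ‖x n‖) F (𝓝 0) := by
    simpa using (mem_nullSeq.1 hx).const_mul ‖gnsVector ρ‖
  exact squeeze_zero (fun n => rhoSharpNorm_nonneg ρ _) (fun n => rhoSharpNorm_le ρ _) h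

lemma IsRhoSharpNull.add {ρ : B →ₚ[ℂ] ℂ} {F : Filter ℕ} {x y : BoundedSeq B}
    (hx : IsRhoSharpNull ρ F x) (hy : IsRhoSharpNull ρ F y) : IsRhoSharpNull ρ F (x + y) := by
  have h := Tendsto.add hx hy
  rw [add_zero] at h
  exact squeeze_zero (fun n => rhoSharpNorm_nonneg ρ _) (fun n => rhoSharpNorm_add_le ρ _ _) h

lemma IsRhoSharpCauchy.add {ρ : B →ₚ[ℂ] ℂ} {F : Filter ℕ} {x y : BoundedSeq B}
    (hx : IsRhoSharpCauchy ρ F x) (hy : IsRhoSharpCauchy ρ F y) :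
    IsRhoSharpCauchy ρ F (x + y) := by
  have h := Tendsto.add hx hy
  rw [add_zero] at h
  refine squeeze_zero (fun n => rhoSharpNorm_nonneg ρ _) (fun p => ?_) h
  have : (x + y) p.1 - (x + y) p.2 = (x p.1 - x p.2) + (y p.1 - y p.2) := by
    simp only [lp.coeFn_add, Pi.add_apply]; abel
  rw [this]
  exact rhoSharpNorm_add_le ρ _ _

lemma IsRhoSharpNull.isRhoSharpCauchy {ρ : B →ₚ[ℂ] ℂ} {F : Filter ℕ} {x : BoundedSeq B}
    (hx : IsRhoSharpNull ρ F x) : IsRhoSharpCauchy ρ F x := by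
  have h := (Tendsto.comp hx (tendsto_fst (f := F) (g := F))).add (Tendsto.comp hx (tendsto_snd (f := F) (g := F)))
  rw [add_zero] at h
  refine squeeze_zero (fun n => rhoSharpNorm_nonneg ρ _) (fun p => ?_) h
  rw [sub_eq_add_neg]
  refine (rhoSharpNorm_add_le ρ _ _).trans_eq ?_
  rw [← neg_one_smul ℂ (x p.2), rhoSharpNorm_smul]
  simp

lemma isRhoSharpNull_congr (ρ : B →ₚ[ℂ] ℂ) {F : Filter ℕ} {x y : BoundedSeq B}
    (h : SeqAlg.mk F x = SeqAlg.mk F y) (hx : IsRhoSharpNull ρ F x) : IsRhoSharpNull ρ F y := by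
  have h' := isRhoSharpNull_of_mem_nullSeq ρ (SeqAlg.mk_eq_mk.1 h.symm)
  simpa using h'.add hx

lemma isRhoSharpCauchy_congr (ρ : B →ₚ[ℂ] ℂ) {F : Filter ℕ} {x y : BoundedSeq B}
    (h : SeqAlg.mk F x = SeqAlg.mk F y) (hx : IsRhoSharpCauchy ρ F x) :
    IsRhoSharpCauchy ρ F y := by
  have h' := isRhoSharpNull_of_mem_nullSeq ρ (SeqAlg.mk_eq_mk.1 h.symm)
  simpa using h'.isRhoSharpCauchy.add hx

/-- Under strong faithfulness, `ρ`-Cauchy bounded sequences are strongly Cauchy under `π_ρ`. -/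
lemma IsStronglyFaithful.tendsto_gns {ρ : B →ₚ[ℂ] ℂ} (hρ : IsStronglyFaithful ρ)
    {F : Filter ℕ} {x : BoundedSeq B}
    (hx : Tendsto (fun p : ℕ × ℕ => rhoNorm ρ (x p.1 - x p.2)) (F ×ˢ F) (𝓝 0)) (η : ρ.GNS) :
    Tendsto (fun p : ℕ × ℕ => ‖ρ.gnsNonUnitalStarAlgHom (x p.1 - x p.2) η‖) (F ×ˢ F) (𝓝 0) := by
  refine Metric.tendsto_nhds.2 fun ε hε => ?_
  obtain ⟨T, hT, hTη⟩ := hρ.exists_commutant η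
    (ε := ε / (2 * (2 * ‖x‖ + 1))) (by positivity)
  have h0 : Tendsto (fun p : ℕ × ℕ => ‖T‖ * rhoNorm ρ (x p.1 - x p.2)) (F ×ˢ F) (𝓝 0) := by
    simpa using hx.const_mul ‖T‖
  filter_upwards [(Metric.tendsto_nhds.1 h0) (ε / 2) (half_pos hε)] with p hp
  rw [dist_zero_right] at hp ⊢
  rw [norm_norm]
  have hp := (le_abs_self _).trans_lt hp
  set b := x p.1 - x p.2 with hb
  have hbx : ‖b‖ ≤ 2 * ‖x‖ := by
    have h1 := boundedSeq_norm_le x p.1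
    have h2 := boundedSeq_norm_le x p.2
    have h3 := norm_sub_le (x p.1) (x p.2)
    rw [← hb] at h3
    linarith
  have hcomm : ρ.gnsNonUnitalStarAlgHom b (T (gnsVector ρ)) =
      T (ρ.gnsNonUnitalStarAlgHom b (gnsVector ρ)) :=
    congrArg (fun S : ρ.GNS →L[ℂ] ρ.GNS => S (gnsVector ρ))
      (VonNeumannAlgebra.mem_commutant_iff.1 hT _ (gns_mem_gnsVN ρ b))
  have h1 : ‖ρ.gnsNonUnitalStarAlgHom b (T (gnsVector ρ))‖ ≤ ‖T‖ * rhoNorm ρ b := by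
    rw [hcomm, ← norm_gns_gnsVector]
    exact T.le_opNorm _
  have h2 : ‖ρ.gnsNonUnitalStarAlgHom b (η - T (gnsVector ρ))‖ ≤ ε / 2 := by
    calc _ ≤ ‖b‖ * ‖η - T (gnsVector ρ)‖ := norm_gns_apply_le _ _ _
      _ ≤ (2 * ‖x‖ + 1) * (ε / (2 * (2 * ‖x‖ + 1))) := by
        gcongr
        linarith
      _ = ε / 2 := by field_simp
  have h3 : ρ.gnsNonUnitalStarAlgHom b η = ρ.gnsNonUnitalStarAlgHom b (η - T (gnsVector ρ)) +
      ρ.gnsNonUnitalStarAlgHom b (T (gnsVector ρ)) := by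
    rw [map_sub (ρ.gnsNonUnitalStarAlgHom b)]; abel
  rw [h3]
  refine (norm_add_le _ _).trans_lt ?_
  linarith

lemma IsStronglyFaithful.rhoCauchy_mul {ρ : B →ₚ[ℂ] ℂ} (hρ : IsStronglyFaithful ρ)
    {F : Filter ℕ} [F.NeBot] {x y : BoundedSeq B}
    (hx : Tendsto (fun p : ℕ × ℕ => rhoNorm ρ (x p.1 - x p.2)) (F ×ˢ F) (𝓝 0))
    (hy : Tendsto (fun p : ℕ × ℕ => rhoNorm ρ (y p.1 - y p.2)) (F ×ˢ F) (𝓝 0)) :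
    Tendsto (fun p : ℕ × ℕ => rhoNorm ρ ((x * y) p.1 - (x * y) p.2)) (F ×ˢ F) (𝓝 0) := by
  set π := ρ.gnsNonUnitalStarAlgHom with hπ
  obtain ⟨η, hη⟩ : ∃ η : ρ.GNS, Tendsto (fun n => π (y n) (gnsVector ρ)) F (𝓝 η) := by
    refine cauchy_map_iff_exists_tendsto.1 (cauchy_map_iff.2 ⟨‹_›, ?_⟩)
    rw [Metric.uniformity_eq_comap_nhds_zero, tendsto_comap_iff]
    refine hy.congr fun p => ?_
    simp only [Function.comp_apply, dist_eq_norm]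
    rw [← norm_gns_gnsVector, map_sub, sub_apply]
  have h1 := hρ.tendsto_gns hx η
  have h2 : Tendsto (fun p : ℕ × ℕ => 2 * ‖x‖ * ‖π (y p.2) (gnsVector ρ) - η‖) (F ×ˢ F) (𝓝 0) := by
    have h : Tendsto (fun n => ‖π (y n) (gnsVector ρ) - η‖) F (𝓝 0) := by
      simpa using (hη.sub_const η).norm
    simpa using (h.comp tendsto_snd).const_mul (2 * ‖x‖)
  have h3 : Tendsto (fun p : ℕ × ℕ => ‖x‖ * rhoNorm ρ (y p.1 - y p.2)) (F ×ˢ F) (𝓝 0) := by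
    simpa using hy.const_mul ‖x‖
  have h := (h1.add h2).add h3
  simp only [add_zero] at h
  refine squeeze_zero (fun n => rhoNorm_nonneg ρ _) (fun p => ?_) h
  have e1 : (x * y) p.1 - (x * y) p.2 =
      (x p.1 - x p.2) * y p.2 + x p.1 * (y p.1 - y p.2) := by
    simp only [lp.infty_coeFn_mul, Pi.mul_apply, sub_mul, mul_sub]; abel
  have hbx : ‖x p.1 - x p.2‖ ≤ 2 * ‖x‖ := by
    have h1 := boundedSeq_norm_le x p.1
    have h2 := boundedSeq_norm_le x p.2
    have h3 := norm_sub_le (x p.1) (x p.2)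
    linarith
  rw [e1]
  refine (rhoNorm_add_le ρ _ _).trans (add_le_add ?_ ?_)
  · rw [← norm_gns_gnsVector, map_mul, mul_apply_eq_comp]
    have e2 : π (x p.1 - x p.2) (π (y p.2) (gnsVector ρ)) =
        π (x p.1 - x p.2) η + π (x p.1 - x p.2) (π (y p.2) (gnsVector ρ) - η) := by
      rw [map_sub (π (x p.1 - x p.2))]; abel
    rw [← hπ, e2]
    refine (norm_add_le _ _).trans (add_le_add le_rfl ?_)
    refine (norm_gns_apply_le ρ _ _).trans ?_
    gcongr
  · refine (rhoNorm_mul_le ρ _ _).trans ?_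
    gcongr
    · exact rhoNorm_nonneg ρ _
    · exact boundedSeq_norm_le x p.1

lemma isRhoSharpCauchy_iff {ρ : B →ₚ[ℂ] ℂ} {F : Filter ℕ} {x : BoundedSeq B} :
    IsRhoSharpCauchy ρ F x ↔
      Tendsto (fun p : ℕ × ℕ => rhoNorm ρ (x p.1 - x p.2)) (F ×ˢ F) (𝓝 0) ∧
      Tendsto (fun p : ℕ × ℕ => rhoNorm ρ ((star x) p.1 - (star x) p.2)) (F ×ˢ F) (𝓝 0) := by
  constructor
  · intro h
    have h2 : Tendsto (fun p : ℕ × ℕ => 2 * rhoSharpNorm ρ (x p.1 - x p.2)) (F ×ˢ F) (𝓝 0) := by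
      simpa using Tendsto.const_mul 2 h
    constructor
    · refine squeeze_zero (fun n => rhoNorm_nonneg ρ _) (fun p => ?_) h2
      have := rhoNorm_nonneg ρ (star (x p.1 - x p.2))
      unfold rhoSharpNorm; linarith
    · refine squeeze_zero (fun n => rhoNorm_nonneg ρ _) (fun p => ?_) h2
      have := rhoNorm_nonneg ρ (x p.1 - x p.2)
      simp only [rhoSharpNorm, lp.star_apply, ← star_sub]; linarith
  · rintro ⟨h1, h2⟩
    have h := (h1.add h2).const_mul (1 / 2)
    simp only [add_zero, mul_zero] at h
    refine h.congr fun p => ?_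
    simp only [rhoSharpNorm, lp.star_apply, ← star_sub]

lemma IsStronglyFaithful.isRhoSharpCauchy_mul {ρ : B →ₚ[ℂ] ℂ} (hρ : IsStronglyFaithful ρ)
    {F : Filter ℕ} [F.NeBot] {x y : BoundedSeq B}
    (hx : IsRhoSharpCauchy ρ F x) (hy : IsRhoSharpCauchy ρ F y) :
    IsRhoSharpCauchy ρ F (x * y) := by
  rw [isRhoSharpCauchy_iff] at hx hy ⊢
  refine ⟨hρ.rhoCauchy_mul hx.1 hy.1, ?_⟩
  rw [star_mul]
  exact hρ.rhoCauchy_mul hy.2 hx.2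

/-- The state-kernel `J_{B,ρ}` (`F = atTop`), respectively `J_{B,ρ}^{(ω)}` (`F = ω`): the classes
of the bounded sequences that tend to zero in the `(ρ,#)`-norm along `F`. -/
def stateKernel (ρ : B →ₚ[ℂ] ℂ) (F : Filter ℕ) : NonUnitalStarSubalgebra ℂ (SeqAlg B F) where
  carrier := {a | ∃ x : BoundedSeq B, SeqAlg.mk F x = a ∧ IsRhoSharpNull ρ F x}
  zero_mem' := ⟨0, rfl, isRhoSharpNull_of_mem_nullSeq ρ (zero_mem _)⟩
  add_mem' := by
    rintro _ _ ⟨x, rfl, hx⟩ ⟨y, rfl, hy⟩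
    exact ⟨x + y, rfl, hx.add hy⟩
  mul_mem' := by
    rintro _ _ ⟨x, rfl, hx⟩ ⟨y, rfl, hy⟩
    refine ⟨x * y, rfl, ?_⟩
    have h := (Tendsto.const_mul ‖x‖ hy).add (Tendsto.const_mul ‖y‖ hx)
    simp only [mul_zero, add_zero] at h
    refine squeeze_zero (fun n => rhoSharpNorm_nonneg ρ _) (fun n => ?_) h
    refine (rhoSharpNorm_mul_le ρ _ _).trans ?_
    gcongr
    · exact rhoSharpNorm_nonneg ρ _
    · exact boundedSeq_norm_le x n
    · exact rhoSharpNorm_nonneg ρ _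
    · exact boundedSeq_norm_le y n
  smul_mem' := by
    rintro c _ ⟨x, rfl, hx⟩
    refine ⟨c • x, rfl, ?_⟩
    have h := Tendsto.const_mul ‖c‖ hx
    rw [mul_zero] at h
    exact h.congr fun n => (rhoSharpNorm_smul ρ c (x n)).symm
  star_mem' := by
    rintro _ ⟨x, rfl, hx⟩
    refine ⟨star x, rfl, hx.congr fun n => ?_⟩
    rw [lp.star_apply, rhoSharpNorm_star]

/-- For a strongly faithful state, the C⋆-algebra `S_{B,ρ}` (`F = atTop`), respectively
`S_{B,ρ}^{(ω)}` (`F = ω`): the classes of the bounded sequences that are `(ρ,#)`-Cauchy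
along `F`. -/
def cauchyAlg (ρ : B →ₚ[ℂ] ℂ) (hρ : IsStronglyFaithful ρ) (F : Filter ℕ) [F.NeBot] :
    NonUnitalStarSubalgebra ℂ (SeqAlg B F) where
  carrier := {a | ∃ x : BoundedSeq B, SeqAlg.mk F x = a ∧ IsRhoSharpCauchy ρ F x}
  zero_mem' := ⟨0, rfl, (isRhoSharpNull_of_mem_nullSeq ρ (zero_mem _)).isRhoSharpCauchy⟩
  add_mem' := by
    rintro _ _ ⟨x, rfl, hx⟩ ⟨y, rfl, hy⟩
    exact ⟨x + y, rfl, hx.add hy⟩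
  mul_mem' := by
    rintro _ _ ⟨x, rfl, hx⟩ ⟨y, rfl, hy⟩
    exact ⟨x * y, rfl, hρ.isRhoSharpCauchy_mul hx hy⟩
  smul_mem' := by
    rintro c _ ⟨x, rfl, hx⟩
    refine ⟨c • x, rfl, ?_⟩
    have h := Tendsto.const_mul ‖c‖ hx
    rw [mul_zero] at h
    refine h.congr fun p => ?_
    rw [← rhoSharpNorm_smul, smul_sub]
    rfl
  star_mem' := by
    rintro _ ⟨x, rfl, hx⟩
    refine ⟨star x, rfl, hx.congr fun p => ?_⟩
    rw [lp.star_apply, lp.star_apply, ← star_sub, rhoSharpNorm_star]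

lemma mk_mem_stateKernel {ρ : B →ₚ[ℂ] ℂ} {F : Filter ℕ} {x : BoundedSeq B} :
    SeqAlg.mk F x ∈ stateKernel ρ F ↔ IsRhoSharpNull ρ F x :=
  ⟨fun ⟨_, hy, h⟩ => isRhoSharpNull_congr ρ hy h, fun h => ⟨x, rfl, h⟩⟩

lemma mk_mem_cauchyAlg {ρ : B →ₚ[ℂ] ℂ} {hρ : IsStronglyFaithful ρ} {F : Filter ℕ} [F.NeBot]
    {x : BoundedSeq B} :
    SeqAlg.mk F x ∈ cauchyAlg ρ hρ F ↔ IsRhoSharpCauchy ρ F x :=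
  ⟨fun ⟨_, hy, h⟩ => isRhoSharpCauchy_congr ρ hy h, fun h => ⟨x, rfl, h⟩⟩

/-- An element of the closure of a set of classes has a representative close to one of them. -/
lemma SeqAlg.exists_near {F : Filter ℕ} {s : Set (SeqAlg B F)} {x : BoundedSeq B}
    (hx : SeqAlg.mk F x ∈ closure s) {ε : ℝ} (hε : 0 < ε) :
    ∃ y : BoundedSeq B, SeqAlg.mk F y ∈ s ∧ ‖x - y‖ < ε := by
  obtain ⟨a, ha, hd⟩ := Metric.mem_closure_iff.1 hx ε hε
  rw [dist_eq_norm] at hd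
  obtain ⟨z, hz, hz'⟩ := SeqAlg.exists_norm_lt (SeqAlg.mk F x - a) (sub_pos.2 hd)
  refine ⟨x - z, ?_, ?_⟩
  · rwa [SeqAlg.mk_sub, hz, sub_sub_cancel]
  · rw [sub_sub_cancel]; linarith

instance (ρ : B →ₚ[ℂ] ℂ) (F : Filter ℕ) :
    IsClosed (stateKernel ρ F : Set (SeqAlg B F)) := by
  refine isClosed_of_closure_subset fun a ha => ?_
  obtain ⟨x, rfl⟩ := SeqAlg.mk_surjective a
  refine mk_mem_stateKernel.2 (Metric.tendsto_nhds.2 fun ε hε => ?_)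
  obtain ⟨y, hy, hxy⟩ := SeqAlg.exists_near ha
    (ε := ε / (2 * (‖gnsVector ρ‖ + 1))) (by positivity)
  filter_upwards [(Metric.tendsto_nhds.1 (mk_mem_stateKernel.1 hy)) (ε / 2) (half_pos hε)]
    with n hn
  rw [dist_zero_right] at hn ⊢
  rw [Real.norm_of_nonneg (rhoSharpNorm_nonneg ρ _)] at hn ⊢
  have h1 : rhoSharpNorm ρ (x n - y n) ≤ ε / 2 := by
    calc _ ≤ ‖gnsVector ρ‖ * ‖x n - y n‖ := rhoSharpNorm_le ρ _
      _ ≤ (‖gnsVector ρ‖ + 1) * (ε / (2 * (‖gnsVector ρ‖ + 1))) := by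
        gcongr
        · linarith
        · exact (boundedSeq_norm_le (x - y) n).trans hxy.le
      _ = ε / 2 := by field_simp
  have h2 := rhoSharpNorm_add_le ρ (x n - y n) (y n)
  rw [sub_add_cancel] at h2
  linarith

instance (ρ : B →ₚ[ℂ] ℂ) (hρ : IsStronglyFaithful ρ) (F : Filter ℕ) [F.NeBot] :
    IsClosed (cauchyAlg ρ hρ F : Set (SeqAlg B F)) := by
  refine isClosed_of_closure_subset fun a ha => ?_
  obtain ⟨x, rfl⟩ := SeqAlg.mk_surjective a
  refine mk_mem_cauchyAlg.2 (Metric.tendsto_nhds.2 fun ε hε => ?_)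
  obtain ⟨y, hy, hxy⟩ := SeqAlg.exists_near ha
    (ε := ε / (4 * (‖gnsVector ρ‖ + 1))) (by positivity)
  filter_upwards [(Metric.tendsto_nhds.1 (mk_mem_cauchyAlg.1 hy)) (ε / 2) (half_pos hε)]
    with p hp
  rw [dist_zero_right] at hp ⊢
  rw [Real.norm_of_nonneg (rhoSharpNorm_nonneg ρ _)] at hp ⊢
  have h1 : rhoSharpNorm ρ ((x p.1 - y p.1) - (x p.2 - y p.2)) ≤ ε / 2 := by
    calc _ ≤ ‖gnsVector ρ‖ * ‖(x p.1 - y p.1) - (x p.2 - y p.2)‖ := rhoSharpNorm_le ρ _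
      _ ≤ (‖gnsVector ρ‖ + 1) *
          (ε / (4 * (‖gnsVector ρ‖ + 1)) + ε / (4 * (‖gnsVector ρ‖ + 1))) := by
        gcongr
        · linarith
        · refine (norm_sub_le _ _).trans (add_le_add ?_ ?_)
          · exact (boundedSeq_norm_le (x - y) p.1).trans hxy.le
          · exact (boundedSeq_norm_le (x - y) p.2).trans hxy.le
      _ = ε / 2 := by field_simp; norm_num
  have h2 := rhoSharpNorm_add_le ρ ((x p.1 - y p.1) - (x p.2 - y p.2)) (y p.1 - y p.2)
  have h3 : (x p.1 - y p.1) - (x p.2 - y p.2) + (y p.1 - y p.2) = x p.1 - x p.2 := by abel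
  rw [h3] at h2
  linarith

end StateKernel

section Extensions

/-- An element of a C⋆-algebra is positive if it is of the form `c* c`. -/
def IsPositiveElement {A : Type*} [NonUnitalCStarAlgebra A] (a : A) : Prop :=
  ∃ c : A, a = star c * c

lemma isPositiveElement_iff {A : Type*} [NonUnitalCStarAlgebra A] [PartialOrder A]
    [StarOrderedRing A] (a : A) : IsPositiveElement a ↔ 0 ≤ a :=
  CStarAlgebra.nonneg_iff_eq_star_mul_self.symm

/-- Cuntz subequivalence `a ≾ b` in the C⋆-algebra `A`. -/
def CuntzLE {A : Type*} [NonUnitalCStarAlgebra A] (a b : A) : Prop :=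
  ∀ ε : ℝ, 0 < ε → ∃ c : A, ‖a - star c * b * c‖ < ε

/-- A C⋆-algebra is simple if it is nonzero and has no closed two-sided ideals other than the zero
ideal and itself. -/
def IsSimpleCStar (A : Type*) [NonUnitalCStarAlgebra A] : Prop :=
  Nontrivial A ∧ ∀ I : TwoSidedIdeal A, IsClosed (I : Set A) → I = ⊥ ∨ I = ⊤

/-- A C⋆-algebra is purely infinite (Kirchberg–Rørdam) if it has no characters and if `a ≾ b` for
all positive `a`, `b` such that `a` lies in the closed two-sided ideal generated by `b`. -/
def IsPurelyInfinite (A : Type*) [NonUnitalCStarAlgebra A] : Prop :=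
  IsEmpty (WeakDual.characterSpace ℂ A) ∧
  ∀ a b : A, IsPositiveElement a → IsPositiveElement b →
    (∀ I : TwoSidedIdeal A, IsClosed (I : Set A) → b ∈ I → a ∈ I) → CuntzLE a b

/-- An extension `0 → I → E → D → 0` of C⋆-algebras, i.e. a short exact sequence. -/
structure CStarExtension (I E D : Type*) [NonUnitalCStarAlgebra I] [NonUnitalCStarAlgebra E]
    [NonUnitalCStarAlgebra D] where
  j : I →⋆ₙₐ[ℂ] E
  q : E →⋆ₙₐ[ℂ] D
  j_injective : Function.Injective j
  exact : ∀ x : E, q x = 0 ↔ x ∈ Set.range j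
  q_surjective : Function.Surjective q

/-- An extension is purely large if every positive element of the ideal is Cuntz subequivalent, in
the middle algebra, to every positive element outside the ideal. -/
def CStarExtension.IsPurelyLarge {I E D : Type*} [NonUnitalCStarAlgebra I]
    [NonUnitalCStarAlgebra E] [NonUnitalCStarAlgebra D] (e : CStarExtension I E D) : Prop :=
  ∀ y : I, IsPositiveElement y → ∀ x : E, IsPositiveElement x → x ∉ Set.range e.j →
    CuntzLE (e.j y) x

/-- An extension `0 → J → S → M → 0`, with `M` the double commutant of `π_ρ(B)`, is the reduced
state-kernel extension along `F` if the first map is the inclusion and the second one sends the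
class of `(x_n)` to the strong-star limit of `π_ρ(x_n)` along `F`. This determines both maps. -/
def IsReducedStateKernelExtension {B : Type*} [NonUnitalCStarAlgebra B] [PartialOrder B]
    [StarOrderedRing B] (ρ : B →ₚ[ℂ] ℂ) (hρ : IsStronglyFaithful ρ) (F : Filter ℕ) [F.NeBot]
    (e : CStarExtension (stateKernel ρ F) (cauchyAlg ρ hρ F) (gnsVN ρ).toStarSubalgebra) : Prop :=
  (∀ y : stateKernel ρ F, ((e.j y : cauchyAlg ρ hρ F) : SeqAlg B F) = y) ∧
  ∀ (x : BoundedSeq B) (hx : SeqAlg.mk F x ∈ cauchyAlg ρ hρ F) (η : ρ.GNS),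
    Tendsto (fun n => ρ.gnsNonUnitalStarAlgHom (x n) η) F
      (𝓝 ((e.q ⟨SeqAlg.mk F x, hx⟩ : ρ.GNS →L[ℂ] ρ.GNS) η)) ∧
    Tendsto (fun n => star (ρ.gnsNonUnitalStarAlgHom (x n)) η) F
      (𝓝 (star (e.q ⟨SeqAlg.mk F x, hx⟩ : ρ.GNS →L[ℂ] ρ.GNS) η))

end Extensions

end

/-! ### Cuntz comparison in simple purely infinite algebras, with control of the `ρ`-seminorms. -/

section PurelyInfinite

variable {B : Type*} [NonUnitalCStarAlgebra B] [PartialOrder B] [StarOrderedRing B]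

/-! Everything is done for one filter `F ≤ atTop`, which covers `atTop` and all free ultrafilters.

Exactness. By strong faithfulness `ξ_ρ` separates `M = π_ρ(B)''`, so it is cyclic for the commutant,
and on bounded sequences `(ρ,#)`-convergence is strong-star convergence. Hence strong-star limits
define a star homomorphism from the Cauchy algebra to `M`, and its kernel is the state-kernel
because an element of `M` that kills `ξ_ρ` is zero. Surjectivity is Kaplansky density:
`exists_bounded_near_of_mem_gnsVN` approximates `T ∈ M` and its adjoint at `ξ_ρ` by elements of `B`
of uniformly bounded norm.

Pure largeness. Let `y = w* w` with `w` in the kernel, and let `x = z* z` lie outside it. The limit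
of `x_n` is nonzero, so `‖x_n‖ ≥ δ > 0` eventually along `F`. `exists_controlled_cuntz` gives `c_n`
with `c_n* x_n c_n` within `1/(n+1)` of `w_n* w_n`, with `‖c_n‖` and `‖c_n‖_ρ` at most `√(4/δ)`
times the corresponding size of `w_n`, and with `‖c_n*‖_ρ ≤ 1/(n+1)`. Thus `c` lies in the
state-kernel and `y = c* x c` exactly.

The point is the smallness of `‖c_n*‖_ρ`. Take `c = d w`, where `d* x d` is close to an approximate
unit element. Such a `d` can be found inside any nonzero hereditary piece of `x`, since all nonzero
positive elements are Cuntz equivalent. Each piece contains two orthogonal nonzero ones, one of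
which carries at most half of the `ρ`-weight, so repeated halving makes `‖d*‖_ρ` as small as desired
while `‖d‖` stays bounded (`exists_small_compression`). A piece that could not be split would come
from a minimal projection `p`; comparison with `p` would then force `B = ℂ p`, which has a character
(`IsPurelyInfinite.isDecomposable`). -/

lemma exists_cut_functions {M : ℝ} (hM : 0 < M) :
    ∃ k h φ : ℝ → ℝ, Continuous k ∧ Continuous h ∧ Continuous φ ∧ k 0 = 0 ∧ h 0 = 0 ∧ φ 0 = 0 ∧
      (∀ t, 0 ≤ k t) ∧ (∀ t, k t ≤ 1) ∧ (∀ t, 0 ≤ h t) ∧ (∀ t, h t = 0 → t ≤ 3 / 4 * M) ∧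
      (∀ t, k t * h t = h t) ∧ (∀ t, t * φ t * φ t * k t = k t) ∧ ∀ t, ‖φ t‖ ≤ √(2 / M) := by
  have hmax (t : ℝ) : 0 < max t (M / 2) := lt_max_of_lt_right (by positivity)
  -- `k` climbs from 0 at `M/2` to 1 at `3M/4`, where `h` starts. `φ` is `t^(-1/2)` on `[M/2, ∞)`,
  -- so `t φ² = 1` wherever `k ≠ 0`, and it is damped below `M/2` so as to be continuous and vanish
  -- at 0.
  refine ⟨fun t => min 1 (max 0 (4 * t / M - 2)), fun t => max 0 (t - 3 / 4 * M),
    fun t => √t / max t (M / 2), by fun_prop, by fun_prop,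
    Real.continuous_sqrt.div (by fun_prop) fun t => (hmax t).ne', by simp, ?_, by simp,
    fun t => le_min zero_le_one (le_max_left _ _), fun t => min_le_left _ _,
    fun t => le_max_left _ _, fun t ht => ?_, fun t => ?_, fun t => ?_, fun t => ?_⟩
  · exact max_eq_left (by linarith)
  · have := le_max_right 0 (t - 3 / 4 * M)
    dsimp only at ht
    linarith
  · dsimp only
    rcases le_total t (3 / 4 * M) with h | h
    · rw [max_eq_left (b := t - 3 / 4 * M) (by linarith), mul_zero]
    · rw [min_eq_left, one_mul]
      refine le_max_of_le_right ?_
      have : 3 ≤ 4 * t / M := by rw [le_div_iff₀ hM]; linarith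
      linarith
  · dsimp only
    rcases le_total t (M / 2) with h | h
    · have h4 : 4 * t / M ≤ 2 := by rw [div_le_iff₀ hM]; linarith
      rw [max_eq_left (b := 4 * t / M - 2) (by linarith), min_eq_right zero_le_one, mul_zero]
    · have ht : 0 < t := by linarith
      have : t * (√t / t) * (√t / t) = 1 := by
        have := Real.sq_sqrt ht.le
        field_simp
        linarith
      rw [max_eq_left h, this, one_mul]
  · dsimp only
    rw [Real.norm_of_nonneg (div_nonneg (Real.sqrt_nonneg _) (hmax t).le)]
    refine Real.le_sqrt_of_sq_le ?_
    rcases le_total t 0 with h0 | h0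
    · rw [Real.sqrt_eq_zero_of_nonpos h0, zero_div, zero_pow two_ne_zero]
      positivity
    · rw [div_pow, Real.sq_sqrt h0, div_le_div_iff₀ (pow_pos (hmax t) 2) hM]
      have h1 := le_max_left t (M / 2)
      have h2 := le_max_right t (M / 2)
      nlinarith

/-- A nonzero positive element `b` admits a positive contraction `k` in its hereditary subalgebra
on which `b` is invertible, and a nonzero positive element `h` on which `k` acts as a unit. -/
lemma exists_spectral_cut {b : B} (hb : 0 ≤ b) (hb0 : b ≠ 0) :
    ∃ k h φ : B, 0 ≤ k ∧ ‖k‖ ≤ 1 ∧ 0 ≤ h ∧ h ≠ 0 ∧ k * h = h ∧ IsSelfAdjoint φ ∧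
      ‖φ‖ ^ 2 * ‖b‖ ≤ 2 ∧ φ * b * φ * k = k ∧ b * φ * φ * k = k := by
  have hsa : IsSelfAdjoint b := .of_nonneg hb
  have hM : 0 < ‖b‖ := norm_pos_iff.2 hb0
  obtain ⟨fk, fh, fp, hk, hh, hp, hk0, hh0, hp0, hk1, hk2, hh1, hh2, hkh, hpk, hpn⟩ :=
    exists_cut_functions hM
  have hmul : b * cfcₙ fp b * cfcₙ fp b * cfcₙ fk b = cfcₙ fk b := by
    have h1 : b * cfcₙ fp b = cfcₙ (fun t => t * fp t) b := by
      rw [cfcₙ_mul (fun t => t) fp b, cfcₙ_id' ℝ b]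
    rw [h1, ← cfcₙ_mul (fun t => t * fp t) fp b (by fun_prop) (by simp),
      ← cfcₙ_mul (fun t => t * fp t * fp t) fk b (by fun_prop) (by simp)]
    exact congrArg (fun f => cfcₙ f b) (funext hpk)
  refine ⟨cfcₙ fk b, cfcₙ fh b, cfcₙ fp b, cfcₙ_nonneg fun t _ => hk1 t, ?_,
    cfcₙ_nonneg fun t _ => hh1 t, ?_, ?_, IsSelfAdjoint.cfcₙ, ?_, ?_, hmul⟩
  · refine norm_cfcₙ_le fun t _ => ?_
    rw [Real.norm_of_nonneg (hk1 t)]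
    exact hk2 t
  -- If `h` vanished, the quasispectrum of `b` would lie in `[0, 3/4 ‖b‖]`, contradicting the norm
  -- of `b`.
  · intro h0
    rw [← cfcₙ_const_zero ℝ b] at h0
    have he := eqOn_of_cfcₙ_eq_cfcₙ h0
    have hle : ‖cfcₙ (id : ℝ → ℝ) b‖ ≤ 3 / 4 * ‖b‖ := by
      refine norm_cfcₙ_le fun t ht => ?_
      rw [id, Real.norm_of_nonneg (quasispectrum_nonneg_of_nonneg b hb t ht)]
      exact hh2 t (he ht)
    rw [cfcₙ_id ℝ b] at hle
    linarith
  · rw [← cfcₙ_mul fk fh b]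
    exact congrArg (fun f => cfcₙ f b) (funext hkh)
  · have h1 : ‖cfcₙ fp b‖ ≤ √(2 / ‖b‖) := norm_cfcₙ_le fun t _ => hpn t
    calc _ ≤ √(2 / ‖b‖) ^ 2 * ‖b‖ := by gcongr
      _ = 2 := by rw [Real.sq_sqrt (by positivity)]; field_simp
  · have h1 : cfcₙ fp b * b = b * cfcₙ fp b := by
      have := cfcₙ_commute_cfcₙ fp (fun t : ℝ => t) b
      rwa [cfcₙ_id' ℝ b] at this
    rw [h1, hmul]

/-- A left unit for a self-adjoint element is a left unit for its positive part. -/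
lemma mul_posPart_eq {u a : B} (ha : IsSelfAdjoint a) (h : u * a = a) : u * a⁺ = a⁺ := by
  have hp : star (a⁺) = a⁺ := (IsSelfAdjoint.of_nonneg (CFC.posPart_nonneg a)).star_eq
  have h1 : a * a⁺ = a⁺ * a⁺ := by
    conv_lhs => rw [← CFC.posPart_sub_negPart a ha]
    rw [CFC.posPart_sub_negPart a ha]
    nth_rw 1 [← CFC.posPart_sub_negPart a ha]
    rw [sub_mul, CFC.negPart_mul_posPart, sub_zero]
  -- With `d = u a⁺ - a⁺`, this kills both terms of `d d* = d a⁺ u* - d a⁺`.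
  have h2 : (u * a⁺ - a⁺) * a⁺ = 0 := by
    rw [sub_mul, mul_assoc, ← h1, ← mul_assoc, h, sub_self]
  rw [← sub_eq_zero, ← CStarRing.mul_star_self_eq_zero_iff]
  rw [star_sub, star_mul, hp, mul_sub, ← mul_assoc, h2, zero_mul, sub_zero]

lemma mul_negPart_eq {u a : B} (ha : IsSelfAdjoint a) (h : u * a = a) : u * a⁻ = a⁻ := by
  rw [← CFC.posPart_neg]
  exact mul_posPart_eq ha.neg (by rw [mul_neg, h])

/-- A positive element is decomposable if its hereditary subalgebra contains two orthogonal nonzero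
positive elements. -/
def IsDecomposable (b : B) : Prop :=
  ∃ b₁ b₂ : B, 0 ≤ b₁ ∧ 0 ≤ b₂ ∧ b₁ ≠ 0 ∧ b₂ ≠ 0 ∧ b₁ * b₂ = 0 ∧
    ∀ u : B, u * b = b → u * b₁ = b₁ ∧ u * b₂ = b₂

/-- The orthogonal elements `a⁺` and `a⁻` inherit the left units of `a`, so they would decompose `b`
if both were nonzero. The condition `hab` plays the role of membership in the hereditary subalgebra
of `b`. -/
lemma nonneg_or_nonpos_of_not_isDecomposable {b : B} (h : ¬ IsDecomposable b) {a : B}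
    (ha : IsSelfAdjoint a) (hab : ∀ u : B, u * b = b → u * a = a) : 0 ≤ a ∨ a ≤ 0 := by
  by_contra! hc
  refine h ⟨a⁺, a⁻, CFC.posPart_nonneg a, CFC.negPart_nonneg a, ?_, ?_,
    CFC.posPart_mul_negPart a, fun u hu => ⟨mul_posPart_eq ha (hab u hu),
      mul_negPart_eq ha (hab u hu)⟩⟩
  · exact fun h0 => hc.2 ((CFC.posPart_eq_zero_iff a ha).1 h0)
  · exact fun h0 => hc.1 ((CFC.negPart_eq_zero_iff a ha).1 h0)

/-- Connectedness of `ℝ`: the parameters with `t • c - a` positive and those with it negative form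
two nonempty closed sets covering the line, so they meet. -/
lemma exists_eq_smul_of_total {a c : B} {r : ℝ} (hr : a ≤ r • c) (hr' : (-r) • c ≤ a)
    (h : ∀ t : ℝ, 0 ≤ t • c - a ∨ t • c - a ≤ 0) : ∃ t : ℝ, a = t • c := by
  have hcl₁ : IsClosed {t : ℝ | 0 ≤ t • c - a} :=
    (CStarAlgebra.isClosed_nonneg (A := B)).preimage (by fun_prop)
  have hcl₂ : IsClosed {t : ℝ | t • c - a ≤ 0} := by
    convert (CStarAlgebra.isClosed_nonneg (A := B)).preimage
      (f := fun t : ℝ => a - t • c) (by fun_prop) using 1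
    ext t
    simp
  have hpre : IsPreconnected (Set.univ : Set ℝ) := isPreconnected_univ
  obtain ⟨t, -, h1, h2⟩ := isPreconnected_closed_iff.1 hpre _ _ hcl₁ hcl₂ (fun t _ => h t)
    ⟨r, trivial, sub_nonneg.2 hr⟩ ⟨-r, trivial, sub_nonpos.2 hr'⟩
  exact ⟨t, (sub_eq_zero.1 (le_antisymm h2 h1)).symm⟩

/-- `b z b` lies between `± ‖z‖ b²`, and each `t b² - b z b` has the left units of `b`, so
indecomposability gives it a sign. -/
lemma exists_corner_eq_smul_mul_self {b : B} (hb : 0 ≤ b) (h : ¬ IsDecomposable b) {z : B}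
    (hz : IsSelfAdjoint z) : ∃ t : ℝ, b * z * b = t • (b * b) := by
  have hs : star b = b := (IsSelfAdjoint.of_nonneg hb).star_eq
  have hle (y : B) (hy : IsSelfAdjoint y) : b * y * b ≤ ‖y‖ • (b * b) := by
    simpa [hs] using CStarAlgebra.star_left_conjugate_le_norm_smul (a := b) (b := y) hy
  refine exists_eq_smul_of_total (hle z hz) ?_ fun t => ?_
  · have := hle (-z) hz.neg
    rw [mul_neg, neg_mul, norm_neg] at this
    rw [neg_smul]
    exact neg_le.1 this
  · refine nonneg_or_nonpos_of_not_isDecomposable h ?_ fun u hu => ?_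
    · rw [IsSelfAdjoint, star_sub, star_smul, star_mul, star_mul, star_mul, hs, hz.star_eq,
        mul_assoc]
      simp
    · rw [mul_sub, mul_smul_comm, ← mul_assoc, ← mul_assoc, ← mul_assoc, hu]

/-- The hereditary subalgebra of an indecomposable element is generated by a minimal projection. -/
lemma exists_minimal_projection {b : B} (hb : 0 ≤ b) (hb0 : b ≠ 0) (h : ¬ IsDecomposable b) :
    ∃ p : B, p ≠ 0 ∧ IsStarProjection p ∧ ∀ z : B, ∃ c : ℂ, p * z * p = c • p := by
  have hs : IsSelfAdjoint b := .of_nonneg hb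
  obtain ⟨s, hs3⟩ := exists_corner_eq_smul_mul_self hb h hs
  have hbb : b * b = s • b := by
    -- The corner identity for `z = b` is `b³ = s b²`, whence `(b² - s b)² = b⁴ - 2s b³ + s² b² =
    -- 0`. So `b² = s b`, and `s⁻¹ b` is the projection.
    rw [← sub_eq_zero, ← CStarRing.star_mul_self_eq_zero_iff]
    have h1 : star (b * b - s • b) = b * b - s • b := by
      simp [hs.star_eq]
    rw [h1, sub_mul, mul_sub, mul_sub]
    simp only [smul_mul_assoc, mul_smul_comm]
    have h4 : b * b * (b * b) = s • (b * b * b) := by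
      rw [← mul_assoc, hs3, smul_mul_assoc, hs3]
    rw [h4, hs3, ← mul_assoc, hs3]
    simp
  have hs0 : s ≠ 0 := by
    rintro rfl
    rw [zero_smul] at hbb
    exact hb0 (CStarRing.star_mul_self_eq_zero_iff b |>.1 (by rwa [hs.star_eq]))
  refine ⟨s⁻¹ • b, smul_ne_zero (inv_ne_zero hs0) hb0, ⟨?_, ?_⟩, fun z => ?_⟩
  · rw [IsIdempotentElem, smul_mul_smul_comm, hbb, smul_smul, mul_assoc, inv_mul_cancel₀ hs0,
      mul_one]
  · simp [IsSelfAdjoint, hs.star_eq]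
  · obtain ⟨t₁, ht₁⟩ := exists_corner_eq_smul_mul_self hb h (realPart z).2
    obtain ⟨t₂, ht₂⟩ := exists_corner_eq_smul_mul_self hb h (imaginaryPart z).2
    have hz : b * z * b = (t₁ + Complex.I * t₂) • (b * b) := by
      conv_lhs => rw [← realPart_add_I_smul_imaginaryPart z]
      rw [mul_add, add_mul, ht₁, mul_smul_comm, smul_mul_assoc, ht₂, add_smul, mul_smul,
        Complex.coe_smul, Complex.coe_smul]
    refine ⟨t₁ + Complex.I * t₂, ?_⟩
    rw [smul_mul_assoc, smul_mul_assoc, mul_smul_comm, hz, hbb, smul_comm s⁻¹ (t₁ + _ : ℂ),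
      smul_comm s⁻¹ (t₁ + _ : ℂ), inv_smul_smul₀ hs0]

/-- Because `‖a‖⁴ = ‖a⁴‖ ≤ ‖a³‖ ‖a‖`. -/
lemma norm_pow_three_le {A : Type*} [NonUnitalCStarAlgebra A] {a : A} (ha : IsSelfAdjoint a) : ‖a‖ ^ 3 ≤ ‖a * a * a‖ := by
  rcases eq_or_ne a 0 with rfl | h0
  · simp
  have h2 : ‖a * a‖ = ‖a‖ * ‖a‖ := by
    simpa [ha.star_eq] using CStarRing.norm_star_mul_self (x := a)
  have h4 : ‖a * a * (a * a)‖ = ‖a * a‖ * ‖a * a‖ := by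
    simpa [ha.star_eq] using CStarRing.norm_star_mul_self (x := a * a)
  have h5 : ‖a * a * (a * a)‖ ≤ ‖a * a * a‖ * ‖a‖ := by
    rw [← mul_assoc]; exact norm_mul_le _ _
  have h6 : 0 < ‖a‖ := norm_pos_iff.2 h0
  rw [h4, h2] at h5
  nlinarith

/-- Over a minimal projection, two rows have a product of full norm. -/
lemma norm_mul_norm_le_of_minimal {A : Type*} [NonUnitalCStarAlgebra A] {p : A} (hp0 : p ≠ 0)
    (hp : IsStarProjection p) (hmin : ∀ z : A, ∃ c : ℂ, p * z * p = c • p) (r s : A) :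
    ‖p * r‖ * ‖p * s‖ ≤ ‖star (p * r) * (p * s)‖ := by
  have hpp : p * p = p := hp.isIdempotentElem
  have hps : star p = p := hp.isSelfAdjoint
  have hn : ‖p‖ = 1 := by
    have := CStarRing.norm_star_mul_self (x := p)
    rw [hps, hpp] at this
    exact (mul_eq_left₀ (norm_ne_zero_iff.2 hp0)).1 this.symm
  obtain ⟨c, hc⟩ := hmin (r * star r)
  have h1 : p * r * star (p * r) = c • p := by
    rw [← hc, star_mul, hps]; simp only [mul_assoc]
  have h2 : ‖p * r‖ * ‖p * r‖ = ‖c‖ := by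
    rw [← CStarRing.norm_self_mul_star, h1, norm_smul, hn, mul_one]
  rcases eq_or_ne (p * r) 0 with h0 | h0
  · simp [h0]
  have h3 : p * r * (star (p * r) * (p * s)) = c • (p * s) := by
    rw [← mul_assoc, h1, smul_mul_assoc, ← mul_assoc, hpp]
  -- The product on the left is `c • (p s)` with `|c| = ‖p r‖²`, so one factor `‖p r‖` cancels.
  have h4 := norm_mul_le (p * r) (star (p * r) * (p * s))
  rw [h3, norm_smul, ← h2, mul_assoc] at h4
  exact le_of_mul_le_mul_left h4 (norm_pos_iff.2 h0)

/-- If every positive element is Cuntz below a minimal projection, then orthogonal positive elements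
vanish. -/
lemma eq_zero_or_eq_zero_of_minimal {p : B} (hp0 : p ≠ 0) (hp : IsStarProjection p)
    (hmin : ∀ z : B, ∃ c : ℂ, p * z * p = c • p) (hle : ∀ a : B, 0 ≤ a → CuntzLE a p)
    {a₁ a₂ : B} (h₁ : 0 ≤ a₁) (h₂ : 0 ≤ a₂) (h : a₁ * a₂ = 0) : a₁ = 0 ∨ a₂ = 0 := by
  by_contra! hne
  have hpp : p * p = p := hp.isIdempotentElem
  have hps : star p = p := hp.isSelfAdjoint
  have hs₁ : IsSelfAdjoint a₁ := .of_nonneg h₁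
  have hs₂ : IsSelfAdjoint a₂ := .of_nonneg h₂
  have h' : a₂ * a₁ = 0 := by
    rw [← hs₂.star_eq, ← hs₁.star_eq, ← star_mul, h, star_zero]
  have hn₁ := norm_pos_iff.2 hne.1
  have hn₂ := norm_pos_iff.2 hne.2
  -- If `r* p r` is within `ε` of `a₁ + a₂`, the rows `p r a₁` and `p r a₂` are almost orthogonal:
  -- their product has norm at most `ε ‖a₁‖ ‖a₂‖`. Over a minimal projection that product has full
  -- norm, while `‖p r aᵢ‖² ≥ 3ε ‖aᵢ‖²` by the factor 4. Squaring gives `9ε² ≤ ε²`, a contradiction.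
  obtain ⟨ε, hε, hε₁, hε₂⟩ : ∃ ε : ℝ, 0 < ε ∧ 4 * ε ≤ ‖a₁‖ ∧ 4 * ε ≤ ‖a₂‖ :=
    ⟨min ‖a₁‖ ‖a₂‖ / 4, by positivity, by linarith [min_le_left ‖a₁‖ ‖a₂‖],
      by linarith [min_le_right ‖a₁‖ ‖a₂‖]⟩
  obtain ⟨r, hr⟩ := hle (a₁ + a₂) (add_nonneg h₁ h₂) ε hε
  set d := a₁ + a₂ - star r * p * r with hd
  have hrr : star r * p * r = a₁ + a₂ - d := by rw [hd]; abel
  have hprod (x y : B) : star (p * (r * x)) * (p * (r * y)) = star x * (a₁ + a₂ - d) * y := by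
    rw [← hrr]
    simp only [star_mul, hps]
    simp only [← mul_assoc]
    simp only [mul_assoc _ p p, hpp]
  have hcross : ‖star (p * (r * a₁)) * (p * (r * a₂))‖ ≤ ε * ‖a₁‖ * ‖a₂‖ := by
    have : star a₁ * (a₁ + a₂ - d) * a₂ = - (a₁ * d * a₂) := by
      rw [hs₁.star_eq, mul_sub, mul_add, h, sub_mul, add_zero, mul_assoc a₁ a₁, h, mul_zero,
        zero_sub]
    rw [hprod, this, norm_neg]
    calc _ ≤ ‖a₁‖ * ‖d‖ * ‖a₂‖ := norm_mul₃_le ..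
      _ ≤ ‖a₁‖ * ε * ‖a₂‖ := by gcongr
      _ = _ := by ring
  have hlow (a : B) (ha : IsSelfAdjoint a) (haa : a * (a₁ + a₂) * a = a * a * a) :
      ‖a‖ ^ 2 * (‖a‖ - ε) ≤ ‖p * (r * a)‖ ^ 2 := by
    have h1 : ‖p * (r * a)‖ ^ 2 = ‖a * a * a - a * d * a‖ := by
      rw [sq, ← CStarRing.norm_star_mul_self, hprod, ha.star_eq, mul_sub, sub_mul, haa]
    have h2 := norm_pow_three_le ha
    have h3 := norm_sub_norm_le (a * a * a) (a * d * a)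
    have h4 : ‖a * d * a‖ ≤ ‖a‖ * ε * ‖a‖ := (norm_mul₃_le ..).trans (by gcongr)
    rw [h1]
    nlinarith
  have k₁ := hlow a₁ hs₁ (by rw [mul_add, h, add_zero])
  have k₂ := hlow a₂ hs₂ (by rw [mul_add, h', zero_add])
  have k := (norm_mul_norm_le_of_minimal hp0 hp hmin (r * a₁) (r * a₂)).trans hcross
  have k₁' : ‖a₁‖ ^ 2 * (3 * ε) ≤ ‖p * (r * a₁)‖ ^ 2 :=
    le_trans (by gcongr; linarith) k₁
  have k₂' : ‖a₂‖ ^ 2 * (3 * ε) ≤ ‖p * (r * a₂)‖ ^ 2 :=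
    le_trans (by gcongr; linarith) k₂
  have k3 : (‖a₁‖ ^ 2 * (3 * ε)) * (‖a₂‖ ^ 2 * (3 * ε)) ≤ (ε * ‖a₁‖ * ‖a₂‖) ^ 2 := by
    calc _ ≤ ‖p * (r * a₁)‖ ^ 2 * ‖p * (r * a₂)‖ ^ 2 := by gcongr
      _ = (‖p * (r * a₁)‖ * ‖p * (r * a₂)‖) ^ 2 := by ring
      _ ≤ _ := by gcongr
  have : 0 < (ε * ‖a₁‖ * ‖a₂‖) ^ 2 := by positivity
  nlinarith

lemma exists_character {A : Type*} [NonUnitalCStarAlgebra A] {p : A} (hp0 : p ≠ 0)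
    (hp : p * p = p) (h : ∀ v : A, ∃ c : ℂ, v = c • p) :
    Nonempty (WeakDual.characterSpace ℂ A) := by
  choose f hf using h
  have huniq {c d : ℂ} (hcd : c • p = d • p) : c = d := smul_left_injective ℂ hp0 hcd
  let g : A →ₗ[ℂ] ℂ :=
    { toFun := f
      map_add' := fun x y => huniq (by rw [← hf, add_smul, ← hf, ← hf])
      map_smul' := fun c x => huniq (by
        rw [← hf, RingHom.id_apply, smul_eq_mul, mul_smul, ← hf]) }
  have hb (v : A) : ‖g v‖ ≤ ‖p‖⁻¹ * ‖v‖ := by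
    have : ‖v‖ = ‖f v‖ * ‖p‖ := by rw [← norm_smul, ← hf]
    have h0 : ‖p‖ ≠ 0 := norm_ne_zero_iff.2 hp0
    refine le_of_eq ?_
    change ‖f v‖ = _
    rw [this]
    field_simp
  refine ⟨⟨StrongDual.toWeakDual (g.mkContinuous _ hb), ?_, fun x y => ?_⟩⟩
  · intro h0
    have h1 : f p = 0 := congrArg (fun φ : WeakDual ℂ A => φ p) h0
    have := hf p
    rw [h1, zero_smul] at this
    exact hp0 this
  · change f (x * y) = f x * f y
    refine huniq ?_
    rw [← hf, mul_smul]
    conv_lhs => rw [hf x, hf y]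
    rw [smul_mul_smul_comm, hp, mul_smul]

/-- Simplicity removes the ideal condition: a closed ideal containing a nonzero `b` is everything.
-/
lemma IsSimpleCStar.cuntzLE (hs : IsSimpleCStar B) (hpi : IsPurelyInfinite B) {a b : B}
    (ha : 0 ≤ a) (hb : 0 ≤ b) (hb0 : b ≠ 0) : CuntzLE a b := by
  refine hpi.2 a b ((isPositiveElement_iff a).2 ha) ((isPositiveElement_iff b).2 hb)
    fun I hI hbI => ?_
  rcases hs.2 I hI with rfl | rfl
  · exact (hb0 ((TwoSidedIdeal.mem_bot B).1 hbI)).elim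
  · trivial

/-- In a simple purely infinite C⋆-algebra every nonzero positive element is decomposable. -/
lemma IsPurelyInfinite.isDecomposable (hs : IsSimpleCStar B) (hpi : IsPurelyInfinite B) {b : B}
    (hb : 0 ≤ b) (hb0 : b ≠ 0) : IsDecomposable b := by
  by_contra h
  obtain ⟨p, hp0, hp, hmin⟩ := exists_minimal_projection hb hb0 h
  have hpp : p * p = p := hp.isIdempotentElem
  have hps : star p = p := hp.isSelfAdjoint
  have hp1 : 0 ≤ p := hp.nonneg
  -- `p` is orthogonal to `(v - v p)* (v - v p)`, and orthogonal positive elements cannot both be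
  -- nonzero. So `p` is a unit and `B = p B p = ℂ p`.
  have hright (v : B) : v * p = v := by
    have hz : (v - v * p) * p = 0 := by rw [sub_mul, mul_assoc, hpp, sub_self]
    have hz' : p * (star (v - v * p) * (v - v * p)) = 0 := by
      rw [← mul_assoc]
      nth_rw 1 [← hps]
      rw [← star_mul, hz, star_zero, zero_mul]
    have := (eq_zero_or_eq_zero_of_minimal hp0 hp hmin
      (fun a ha => hs.cuntzLE hpi ha hp1 hp0) hp1 (star_mul_self_nonneg _) hz').resolve_left hp0
    exact (sub_eq_zero.1 ((CStarRing.star_mul_self_eq_zero_iff _).1 this)).symm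
  have hleft (v : B) : p * v = v := by
    rw [← star_star (p * v), star_mul, hps, hright, star_star]
  refine (not_isEmpty_iff.2 (exists_character hp0 hpp fun v => ?_)) hpi.1
  obtain ⟨c, hc⟩ := hmin v
  exact ⟨c, by rw [← hc, hleft, hright]⟩

lemma sq_rhoNorm (ρ : B →ₚ[ℂ] ℂ) (c : B) : rhoNorm ρ c ^ 2 = (ρ (star c * c)).re := by
  refine Real.sq_sqrt ?_
  have : 0 ≤ ρ (star c * c) := map_nonneg ρ (star_mul_self_nonneg c)
  exact (Complex.le_def.1 this).1

lemma re_mono {A : Type*} [NonUnitalCStarAlgebra A] [PartialOrder A] (ρ : A →ₚ[ℂ] ℂ) {a b : A} (h : a ≤ b) : (ρ a).re ≤ (ρ b).re :=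
  (Complex.le_def.1 (OrderHomClass.mono ρ h)).1

/-- Orthogonality gives `s² = k₁⁴ + k₂⁴ ≤ k₁² + k₂² = s`, hence `‖s‖² ≤ ‖s‖`. -/
lemma norm_orthogonal_squares_le_one {A : Type*} [NonUnitalCStarAlgebra A] [PartialOrder A]
    [StarOrderedRing A] {k₁ k₂ : A} (h₁ : IsSelfAdjoint k₁) (h₂ : IsSelfAdjoint k₂)
    (hn₁ : ‖k₁‖ ≤ 1) (hn₂ : ‖k₂‖ ≤ 1) (h : k₁ * k₂ = 0) : ‖k₁ * k₁ + k₂ * k₂‖ ≤ 1 := by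
  have h' : k₂ * k₁ = 0 := by
    rw [← h₂.star_eq, ← h₁.star_eq, ← star_mul, h, star_zero]
  set s := k₁ * k₁ + k₂ * k₂ with hs
  have hs0 : 0 ≤ s := add_nonneg
    (by simpa [h₁.star_eq] using star_mul_self_nonneg k₁)
    (by simpa [h₂.star_eq] using star_mul_self_nonneg k₂)
  have hsa : star s = s := (IsSelfAdjoint.of_nonneg hs0).star_eq
  have hq (k : A) (hk : IsSelfAdjoint k) (hn : ‖k‖ ≤ 1) : k * (k * k) * k ≤ k * k := by
    have hkk : IsSelfAdjoint (k * k) := by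
      rw [IsSelfAdjoint, star_mul, hk.star_eq]
    have h1 := CStarAlgebra.star_left_conjugate_le_norm_smul (a := k) hkk
    rw [hk.star_eq] at h1
    refine h1.trans ?_
    have h2 : ‖k * k‖ ≤ 1 := (norm_mul_le k k).trans (by nlinarith [norm_nonneg k])
    have h3 : 0 ≤ k * k := by simpa [hk.star_eq] using star_mul_self_nonneg k
    calc ‖k * k‖ • (k * k) ≤ (1 : ℝ) • (k * k) := smul_le_smul_of_nonneg_right h2 h3
      _ = k * k := one_smul _ _
  have hss : s * s = k₁ * (k₁ * k₁) * k₁ + k₂ * (k₂ * k₂) * k₂ := by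
    rw [hs, mul_add, add_mul, add_mul]
    have e1 : k₂ * k₂ * (k₁ * k₁) = 0 := by rw [mul_assoc, ← mul_assoc k₂ k₁, h']; simp
    have e2 : k₁ * k₁ * (k₂ * k₂) = 0 := by rw [mul_assoc, ← mul_assoc k₁ k₂, h]; simp
    rw [e1, e2]
    simp only [mul_assoc, add_zero, zero_add]
  have hle : s * s ≤ s := hss ▸ add_le_add (hq k₁ h₁ hn₁) (hq k₂ h₂ hn₂)
  have h3 : ‖s‖ * ‖s‖ ≤ ‖s‖ := by
    have : 0 ≤ s * s := by simpa [hsa] using star_mul_self_nonneg s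
    have h4 := CStarAlgebra.norm_le_norm_of_nonneg_of_le this hle
    have h5 := CStarRing.norm_star_mul_self (x := s)
    rwa [← h5, hsa]
  by_contra! hlt
  nlinarith

/-- Halving a spectral cut: one of two orthogonal pieces has at most half of the weight. -/
lemma exists_half_cut (hs : IsSimpleCStar B) (hpi : IsPurelyInfinite B) (ρ : B →ₚ[ℂ] ℂ) {φ : B}
    (hφ : IsSelfAdjoint φ) {k h : B} (hk : 0 ≤ k) (hh : 0 ≤ h) (hh0 : h ≠ 0)
    (hkh : k * h = h) :
    ∃ k' h' : B, 0 ≤ k' ∧ ‖k'‖ ≤ 1 ∧ 0 ≤ h' ∧ h' ≠ 0 ∧ k' * h' = h' ∧ k * k' = k' ∧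
      2 * rhoNorm ρ (k' * φ) ^ 2 ≤ rhoNorm ρ (k * φ) ^ 2 := by
  obtain ⟨b₁, b₂, hb₁, hb₂, hb₁0, hb₂0, hbb, hu⟩ := hpi.isDecomposable hs hh hh0
  obtain ⟨k₁, h₁, φ₁, hk₁, hkn₁, hh₁, hh₁0, hkh₁, hφ₁, -, -, hc₁⟩ := exists_spectral_cut hb₁ hb₁0
  obtain ⟨k₂, h₂, φ₂, hk₂, hkn₂, hh₂, hh₂0, hkh₂, hφ₂, -, -, hc₂⟩ := exists_spectral_cut hb₂ hb₂0
  have hks : star k = k := (IsSelfAdjoint.of_nonneg hk).star_eq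
  have hs₁ : IsSelfAdjoint k₁ := .of_nonneg hk₁
  have hs₂ : IsSelfAdjoint k₂ := .of_nonneg hk₂
  -- The formula `kᵢ = bᵢ φᵢ φᵢ kᵢ` transfers to `kᵢ` both the left units of `bᵢ` and the
  -- orthogonality of `b₁` and `b₂`.
  have hkk₁ : k * k₁ = k₁ := by
    rw [← hc₁, ← mul_assoc, ← mul_assoc, ← mul_assoc, (hu k hkh).1]
  have hkk₂ : k * k₂ = k₂ := by
    rw [← hc₂, ← mul_assoc, ← mul_assoc, ← mul_assoc, (hu k hkh).2]
  have horth : k₁ * k₂ = 0 := by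
    rw [← hs₁.star_eq, ← hc₁, ← hc₂]
    simp only [star_mul, mul_assoc, (IsSelfAdjoint.of_nonneg hb₁).star_eq]
    rw [← mul_assoc b₁ b₂, hbb]
    simp
  -- The squares are the weights `ρ(φ kᵢ² φ)`; since `s = k s k` and `‖s‖ ≤ 1`, one has `φ s φ ≤ φ
  -- k² φ`.
  have hsum : rhoNorm ρ (k₁ * φ) ^ 2 + rhoNorm ρ (k₂ * φ) ^ 2 ≤ rhoNorm ρ (k * φ) ^ 2 := by
    rw [sq_rhoNorm, sq_rhoNorm, sq_rhoNorm, ← Complex.add_re, ← map_add]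
    refine re_mono ρ ?_
    set s := k₁ * k₁ + k₂ * k₂ with hsdef
    have hs0 : IsSelfAdjoint s := by
      simp [hsdef, IsSelfAdjoint, hs₁.star_eq, hs₂.star_eq]
    have hks' : k * s * k = s := by
      have e1 : k₁ * k = k₁ := by rw [← hs₁.star_eq, ← hks, ← star_mul, hkk₁]
      have e2 : k₂ * k = k₂ := by rw [← hs₂.star_eq, ← hks, ← star_mul, hkk₂]
      rw [hsdef, mul_add, add_mul, ← mul_assoc, ← mul_assoc, hkk₁, hkk₂, mul_assoc, mul_assoc,
        e1, e2]
    calc star (k₁ * φ) * (k₁ * φ) + star (k₂ * φ) * (k₂ * φ)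
        = star (k * φ) * s * (k * φ) := by
          have : star (k * φ) * s * (k * φ) = φ * (k * s * k) * φ := by
            simp only [star_mul, hks, hφ.star_eq, mul_assoc]
          rw [this, hks', hsdef]
          simp only [star_mul, hφ.star_eq, hs₁.star_eq, hs₂.star_eq, mul_add, add_mul, mul_assoc]
      _ ≤ ‖s‖ • (star (k * φ) * (k * φ)) := CStarAlgebra.star_left_conjugate_le_norm_smul hs0
      _ ≤ (1 : ℝ) • (star (k * φ) * (k * φ)) := smul_le_smul_of_nonneg_right
          (norm_orthogonal_squares_le_one hs₁ hs₂ hkn₁ hkn₂ horth) (star_mul_self_nonneg _)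
      _ = _ := one_smul _ _
  rcases le_total (rhoNorm ρ (k₁ * φ) ^ 2) (rhoNorm ρ (k₂ * φ) ^ 2) with hle | hle
  · exact ⟨k₁, h₁, hk₁, hkn₁, hh₁, hh₁0, hkh₁, hkk₁, by linarith⟩
  · exact ⟨k₂, h₂, hk₂, hkn₂, hh₂, hh₂0, hkh₂, hkk₂, by linarith⟩

/-- `m` successive halvings. Left units persist, so an identity such as `φ x φ k = k` survives the
shrinking of `k`. -/
lemma exists_small_cut (hs : IsSimpleCStar B) (hpi : IsPurelyInfinite B) (ρ : B →ₚ[ℂ] ℂ) {φ : B}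
    (hφ : IsSelfAdjoint φ) {k h : B} (hk : 0 ≤ k) (hkn : ‖k‖ ≤ 1) (hh : 0 ≤ h) (hh0 : h ≠ 0)
    (hkh : k * h = h) (m : ℕ) :
    ∃ k' h' : B, 0 ≤ k' ∧ ‖k'‖ ≤ 1 ∧ 0 ≤ h' ∧ h' ≠ 0 ∧ k' * h' = h' ∧
      (∀ u : B, u * k = k → u * k' = k') ∧
      2 ^ m * rhoNorm ρ (k' * φ) ^ 2 ≤ rhoNorm ρ (k * φ) ^ 2 := by
  induction m with
  | zero => exact ⟨k, h, hk, hkn, hh, hh0, hkh, fun u hu => hu, by simp⟩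
  | succ m ih =>
    obtain ⟨k₁, h₁, hk₁, -, hh₁, hh₁0, hkh₁, hu, hle⟩ := ih
    obtain ⟨k₂, h₂, hk₂, hkn₂, hh₂, hh₂0, hkh₂, hkk, hle₂⟩ :=
      exists_half_cut hs hpi ρ hφ hk₁ hh₁ hh₁0 hkh₁
    refine ⟨k₂, h₂, hk₂, hkn₂, hh₂, hh₂0, hkh₂, fun v hv => ?_, ?_⟩
    · rw [← hkk, ← mul_assoc, hu v hv]
    · have : (0 : ℝ) < 2 ^ m := by positivity
      rw [pow_succ]
      nlinarith

/-- Positive contractions are compressions of any nonzero positive element by elements of controlled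
norm whose adjoint is small in the `ρ`-seminorm. -/
lemma exists_small_compression (hs : IsSimpleCStar B) (hpi : IsPurelyInfinite B) (ρ : B →ₚ[ℂ] ℂ)
    {x e : B} (hx : 0 ≤ x) (hx0 : x ≠ 0) (he : 0 ≤ e) (hen : ‖e‖ ≤ 1) {ε : ℝ} (hε : 0 < ε)
    (hε1 : ε ≤ 1) :
    ∃ d : B, ‖e - star d * x * d‖ < ε ∧ ‖d‖ ^ 2 * ‖x‖ ≤ 4 ∧ rhoNorm ρ (star d) ≤ ε := by
  obtain ⟨k₀, h₀, φ, hk₀, hkn₀, hh₀, hh₀0, hkh₀, hφ, hφn, hφk₀, -⟩ := exists_spectral_cut hx hx0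
  obtain ⟨m, hm⟩ := pow_unbounded_of_one_lt (2 * rhoNorm ρ (k₀ * φ) ^ 2 / ε ^ 2) one_lt_two
  obtain ⟨k, h, hk, hkn, hh, hh0, hkh, hu, hle⟩ :=
    exists_small_cut hs hpi ρ hφ hk₀ hkn₀ hh₀ hh₀0 hkh₀ m
  have hφk : φ * x * φ * k = k := hu _ hφk₀
  have hks : star k = k := (IsSelfAdjoint.of_nonneg hk).star_eq
  have hhs : star h = h := (IsSelfAdjoint.of_nonneg hh).star_eq
  have hh2 : 0 ≤ h * h := by simpa [hhs] using star_mul_self_nonneg h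
  have hh20 : h * h ≠ 0 := fun h1 =>
    hh0 ((CStarRing.star_mul_self_eq_zero_iff h).1 (by rwa [hhs]))
  -- However small the piece carrying `h`, `e` is Cuntz below `h²`. With `s = h r = k s` and `d = φ
  -- s`, the identity `φ x φ k = k` gives `d* x d = s* s`, and `d* = s* k φ` is small because `k φ`
  -- is.
  obtain ⟨r, hr⟩ := hs.cuntzLE hpi he hh2 hh20 ε hε
  set s := h * r with hsdef
  have hss : star s * s = star r * (h * h) * r := by
    simp only [hsdef, star_mul, hhs, mul_assoc]
  have hksn : k * s = s := by rw [hsdef, ← mul_assoc, hkh]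
  rw [← hss] at hr
  -- `‖s‖² ≤ ‖e‖ + ε ≤ 2`, which is where `ε ≤ 1` enters. Together with `‖φ‖² ‖x‖ ≤ 2` it yields the
  -- constant 4.
  have hsn : ‖s‖ ^ 2 ≤ 2 := by
    rw [sq, ← CStarRing.norm_star_mul_self]
    have := norm_sub_norm_le (star s * s) e
    rw [norm_sub_rev] at this
    linarith
  refine ⟨φ * s, ?_, ?_, ?_⟩
  · have : star (φ * s) * x * (φ * s) = star s * s := by
      conv_lhs => rw [← hksn]
      conv_rhs => rw [← hksn]
      have e1 : star (φ * (k * s)) * x * (φ * (k * s)) = star s * star k * (φ * x * φ * k) * s := by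
        simp only [star_mul, hφ.star_eq, mul_assoc]
      rw [e1, hφk]
      simp only [star_mul, mul_assoc]
    rwa [this]
  · calc ‖φ * s‖ ^ 2 * ‖x‖ ≤ (‖φ‖ * ‖s‖) ^ 2 * ‖x‖ := by gcongr; exact norm_mul_le _ _
      _ = (‖φ‖ ^ 2 * ‖x‖) * ‖s‖ ^ 2 := by ring
      _ ≤ 2 * 2 := by gcongr
      _ = 4 := by norm_num
  · have h1 : star (φ * s) = star s * (k * φ) := by
      conv_lhs => rw [← hksn]
      simp only [star_mul, hφ.star_eq, hks, mul_assoc]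
    rw [h1]
    refine abs_le_of_sq_le_sq' ?_ hε.le |>.2
    have h2 := rhoNorm_mul_le ρ (star s) (k * φ)
    rw [norm_star] at h2
    have h3 : 2 * rhoNorm ρ (k * φ) ^ 2 ≤ ε ^ 2 := by
      rw [div_lt_iff₀ (by positivity)] at hm
      have hp : (0 : ℝ) < 2 ^ m := by positivity
      nlinarith
    calc _ ≤ (‖s‖ * rhoNorm ρ (k * φ)) ^ 2 := by
          gcongr
          exact rhoNorm_nonneg ρ _
      _ = ‖s‖ ^ 2 * rhoNorm ρ (k * φ) ^ 2 := by ring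
      _ ≤ 2 * rhoNorm ρ (k * φ) ^ 2 := by gcongr
      _ ≤ ε ^ 2 := h3

/-- Quantitative Cuntz subequivalence with control of the `ρ`-seminorms. -/
lemma exists_controlled_cuntz (hs : IsSimpleCStar B) (hpi : IsPurelyInfinite B) (ρ : B →ₚ[ℂ] ℂ)
    {x : B} (hx : 0 ≤ x) (w : B) {δ : ℝ} (hδ : 0 < δ) (hxδ : δ ≤ ‖x‖) {ε : ℝ} (hε : 0 < ε) :
    ∃ c : B, ‖star w * w - star c * x * c‖ ≤ ε ∧ ‖c‖ ≤ √(4 / δ) * ‖w‖ ∧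
      rhoNorm ρ c ≤ √(4 / δ) * rhoNorm ρ w ∧ rhoNorm ρ (star c) ≤ ε := by
  have hx0 : x ≠ 0 := norm_pos_iff.1 (hδ.trans_le hxδ)
  -- For `c = d w` the Cuntz error is at most `ε' (‖w‖ + ‖w‖²)`, from `e w ≈ w` and `d* x d ≈ e`,
  -- and `‖c*‖_ρ ≤ ε' ‖w‖`.
  obtain ⟨ε', hε', hε1, hε2⟩ : ∃ ε' : ℝ, 0 < ε' ∧ ε' ≤ 1 ∧ ε' * (‖w‖ ^ 2 + ‖w‖ + 1) ≤ ε := by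
    have hp : 0 < ‖w‖ ^ 2 + ‖w‖ + 1 := by positivity
    refine ⟨min 1 (ε / (‖w‖ ^ 2 + ‖w‖ + 1)), lt_min one_pos (by positivity), min_le_left _ _, ?_⟩
    rw [← le_div_iff₀ hp]
    exact min_le_right _ _
  have hl := CStarAlgebra.increasingApproximateUnit B
  have h1 := (Metric.tendsto_nhds.1 (hl.tendsto_mul_right w)) ε' hε'
  obtain ⟨e, hew, hen, he0⟩ := (h1.and (hl.eventually_norm.and hl.eventually_nonneg)).exists
  rw [dist_eq_norm, norm_sub_rev] at hew
  obtain ⟨d, hd, hdn, hdρ⟩ := exists_small_compression hs hpi ρ hx hx0 he0 hen hε' hε1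
  have hdn' : ‖d‖ ≤ √(4 / δ) := by
    refine Real.le_sqrt_of_sq_le ?_
    rw [le_div_iff₀ hδ]
    exact (mul_le_mul_of_nonneg_left hxδ (by positivity)).trans hdn
  refine ⟨d * w, ?_, ?_, ?_, ?_⟩
  · have e1 : star w * w - star (d * w) * x * (d * w) =
        star w * (w - e * w) + star w * (e - star d * x * d) * w := by
      simp only [star_mul, mul_sub, sub_mul, mul_assoc]; abel
    rw [e1]
    have h2 : ‖star w * (w - e * w)‖ ≤ ‖w‖ * ε' := by
      refine (norm_mul_le _ _).trans ?_
      rw [norm_star]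
      gcongr
    have h3 : ‖star w * (e - star d * x * d) * w‖ ≤ ‖w‖ * ε' * ‖w‖ := by
      refine (norm_mul₃_le ..).trans ?_
      rw [norm_star]
      gcongr
    refine (norm_add_le _ _).trans ?_
    nlinarith
  · exact (norm_mul_le _ _).trans (by gcongr)
  · refine (rhoNorm_mul_le ρ _ _).trans ?_
    gcongr
    exact rhoNorm_nonneg ρ _
  · rw [star_mul]
    refine (rhoNorm_mul_le ρ _ _).trans ?_
    rw [norm_star]
    nlinarith [norm_nonneg w, rhoNorm_nonneg ρ (star d), mul_le_mul_of_nonneg_left hdρ (norm_nonneg w), mul_nonneg hε'.le (sq_nonneg ‖w‖)]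

end PurelyInfinite

/-! ### Density theorems: double commutant and Kaplansky for nondegenerate representations. -/

section DoubleCommutant

variable {H : Type*} [NormedAddCommGroup H] [InnerProductSpace ℂ H]
  {ι : Type*} [Fintype ι]

/-- The diagonal amplification of an operator. -/
noncomputable def amplification (ι : Type*) [Fintype ι] (S : H →L[ℂ] H) :
    PiLp 2 (fun _ : ι => H) →L[ℂ] PiLp 2 (fun _ : ι => H) :=
  (PiLp.continuousLinearEquiv 2 ℂ (fun _ : ι => H)).symm.toContinuousLinearMap ∘L
    ContinuousLinearMap.piMap (fun _ => S) ∘L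
    (PiLp.continuousLinearEquiv 2 ℂ (fun _ : ι => H)).toContinuousLinearMap

@[simp]
lemma amplification_apply (S : H →L[ℂ] H) (y : PiLp 2 (fun _ : ι => H)) (i : ι) :
    amplification ι S y i = S (y i) := rfl

/-- The matrix entries of an operator on a finite direct sum. -/
noncomputable def matrixEntry {ι : Type*} [DecidableEq ι]
    (P : PiLp 2 (fun _ : ι => H) →L[ℂ] PiLp 2 (fun _ : ι => H)) (i j : ι) : H →L[ℂ] H :=
  ContinuousLinearMap.proj i ∘L
    (PiLp.continuousLinearEquiv 2 ℂ (fun _ : ι => H)).toContinuousLinearMap ∘L P ∘L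
    (PiLp.continuousLinearEquiv 2 ℂ (fun _ : ι => H)).symm.toContinuousLinearMap ∘L
    ContinuousLinearMap.single ℂ (fun _ : ι => H) j

lemma matrixEntry_apply {ι : Type*} [DecidableEq ι]
    (P : PiLp 2 (fun _ : ι => H) →L[ℂ] PiLp 2 (fun _ : ι => H)) (i j : ι) (h : H) :
    matrixEntry P i j h = P (WithLp.toLp 2 (Pi.single j h)) i := rfl

lemma sum_matrixEntry [DecidableEq ι]
    (P : PiLp 2 (fun _ : ι => H) →L[ℂ] PiLp 2 (fun _ : ι => H)) (y : PiLp 2 (fun _ : ι => H))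
    (i : ι) : ∑ j, matrixEntry P i j (y j) = P y i := by
  have hy : y = ∑ j, WithLp.toLp 2 (Pi.single j (y j)) := by
    ext k
    simp [Finset.sum_pi_single]
  conv_rhs => rw [hy, map_sum]
  simp [matrixEntry_apply]

/-- An operator on a direct sum commutes with the amplification of `S` iff its entries commute with
`S`. -/
lemma amplification_commute_iff [DecidableEq ι]
    (P : PiLp 2 (fun _ : ι => H) →L[ℂ] PiLp 2 (fun _ : ι => H)) (S : H →L[ℂ] H) :
    (∀ y, P (amplification ι S y) = amplification ι S (P y)) ↔
      ∀ i j, S * matrixEntry P i j = matrixEntry P i j * S := by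
  constructor
  · intro h i j
    ext v
    have h1 : amplification ι S (WithLp.toLp 2 (Pi.single j v)) =
        WithLp.toLp 2 (Pi.single j (S v)) := by
      ext k
      rw [amplification_apply]
      rcases eq_or_ne k j with rfl | hk
      · simp
      · simp [hk]
    have h2 := congrArg (fun y : PiLp 2 (fun _ : ι => H) => y i)
      (h (WithLp.toLp 2 (Pi.single j v)))
    rw [h1] at h2
    simpa [matrixEntry_apply] using h2.symm
  · intro h y
    ext i
    rw [amplification_apply, ← sum_matrixEntry, ← sum_matrixEntry, map_sum]
    refine Finset.sum_congr rfl fun j _ => ?_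
    exact (congrArg (fun R : H →L[ℂ] H => R (y j)) (h i j)).symm

variable [CompleteSpace H]

lemma inner_amplification (S : H →L[ℂ] H) (x y : PiLp 2 (fun _ : ι => H)) :
    ⟪x, amplification ι S y⟫_ℂ = ⟪amplification ι (star S) x, y⟫_ℂ := by
  simp only [PiLp.inner_apply, amplification_apply, ContinuousLinearMap.star_eq_adjoint,
    ContinuousLinearMap.adjoint_inner_left]

variable {B : Type*} [NonUnitalCStarAlgebra B]

/-- The density half of von Neumann's double commutant theorem. -/
lemma exists_near_of_mem_doubleCommutant (π : B →⋆ₙₐ[ℂ] (H →L[ℂ] H))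
    (hπ : ∀ w, (∀ b, π b w = 0) → w = 0) {T : H →L[ℂ] H}
    (hT : T ∈ Set.centralizer (Set.centralizer (Set.range π))) (v : ι → H) {ε : ℝ} (hε : 0 < ε) :
    ∃ b, ∀ i, ‖T (v i) - π b (v i)‖ < ε := by
  classical
  let V : PiLp 2 (fun _ : ι => H) := WithLp.toLp 2 v
  let L : B →ₗ[ℂ] PiLp 2 (fun _ : ι => H) :=
    { toFun := fun b => amplification ι (π b) V
      map_add' := fun a b => by ext i; simp
      map_smul' := fun c b => by ext i; simp }
  let K := (LinearMap.range L).topologicalClosure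
  have : CompleteSpace K := (LinearMap.range L).isClosed_topologicalClosure.completeSpace_coe
  have hLK (b : B) : amplification ι (π b) V ∈ K :=
    Submodule.le_topologicalClosure _ ⟨b, rfl⟩
  have hinv (b : B) : ∀ y ∈ K, amplification ι (π b) y ∈ K := by
    intro y hy
    refine map_mem_closure (amplification ι (π b)).continuous hy ?_
    rintro _ ⟨a, rfl⟩
    refine ⟨b * a, ?_⟩
    ext i
    simp [L]
  have hinv' (b : B) : ∀ y ∈ Kᗮ, amplification ι (π b) y ∈ Kᗮ := by
    intro y hy
    rw [Submodule.mem_orthogonal] at hy ⊢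
    intro u hu
    rw [inner_amplification, ← map_star]
    exact hy _ (hinv _ u hu)
  have hcomm (b : B) (y : PiLp 2 (fun _ : ι => H)) :
      K.starProjection (amplification ι (π b) y) = amplification ι (π b) (K.starProjection y) := by
    have h1 : amplification ι (π b) y = amplification ι (π b) (K.starProjection y) +
        amplification ι (π b) (y - K.starProjection y) := by
      rw [← map_add, add_sub_cancel]
    rw [h1, map_add, (K.starProjection_apply_eq_zero_iff).2
      (hinv' b _ (K.sub_starProjection_mem_orthogonal y)), add_zero,
      Submodule.starProjection_eq_self_iff]
    exact hinv b _ (K.starProjection_apply_mem y)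
  -- The matrix entries of the projection onto `K` commute with `π(B)`, hence with `T`.
  have hTcomm (y : PiLp 2 (fun _ : ι => H)) :
      K.starProjection (amplification ι T y) = amplification ι T (K.starProjection y) := by
    refine (amplification_commute_iff K.starProjection T).2 (fun i j => ?_) y
    refine (hT _ ?_).symm
    rintro _ ⟨b, rfl⟩
    exact (amplification_commute_iff K.starProjection (π b)).1 (hcomm b) i j
  -- `B` may have no unit, so nondegeneracy is needed here: every `π b` kills the components of `V -
  -- P V`, with `P` the projection onto `K`.
  have hV : V ∈ K := by
    rw [← Submodule.starProjection_eq_self_iff, eq_comm, ← sub_eq_zero]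
    ext i
    refine hπ _ fun b => ?_
    have h1 : amplification ι (π b) (V - K.starProjection V) = 0 := by
      rw [map_sub, ← hcomm, (Submodule.starProjection_eq_self_iff).2 (hLK b), sub_self]
    exact congrArg (fun y : PiLp 2 (fun _ : ι => H) => y i) h1
  have hTV : amplification ι T V ∈ K := by
    rw [← Submodule.starProjection_eq_self_iff, hTcomm,
      (Submodule.starProjection_eq_self_iff).2 hV]
  obtain ⟨_, ⟨b, rfl⟩, hd⟩ := Metric.mem_closure_iff.1 hTV ε hε
  refine ⟨b, fun i => ?_⟩
  rw [dist_eq_norm] at hd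
  exact (PiLp.norm_apply_le (amplification ι T V - L b) i).trans_lt hd

/-- Self-adjoint elements of the double commutant are approximated by self-adjoint elements. -/
lemma exists_selfAdjoint_near_of_mem_doubleCommutant (π : B →⋆ₙₐ[ℂ] (H →L[ℂ] H))
    (hπ : ∀ w, (∀ b, π b w = 0) → w = 0) {T : H →L[ℂ] H}
    (hT : T ∈ Set.centralizer (Set.centralizer (Set.range π))) (hTs : IsSelfAdjoint T)
    (v : ι → H) {ε : ℝ} (hε : 0 < ε) :
    ∃ b, IsSelfAdjoint b ∧ ∀ i, ‖T (v i) - π b (v i)‖ < ε := by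
  let V : PiLp 2 (fun _ : ι => H) := WithLp.toLp 2 v
  let C₀ : Set (PiLp 2 (fun _ : ι => H)) :=
    {y | ∃ b : B, IsSelfAdjoint b ∧ amplification ι (π b) V = y}
  have hconv : Convex ℝ (closure C₀) := by
    refine Convex.closure ?_
    rintro _ ⟨a, ha, rfl⟩ _ ⟨b, hb, rfl⟩ s t - - -
    refine ⟨(s : ℂ) • a + (t : ℂ) • b, ?_, ?_⟩
    · simp [IsSelfAdjoint, ha.star_eq, hb.star_eq]
    · ext i
      rw [amplification_apply, map_add, map_smul, map_smul]
      simp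
  -- The adjoint is not strongly continuous, so approximants cannot simply be replaced by their
  -- self-adjoint parts. A vector `w` separating `T V` from `C₀` satisfies `Re⟨w, π(b) V⟩ = 0` for
  -- self-adjoint `b`, by scaling. Applied to `b + b*`, this reads `Re⟨w, π(b) V⟩ + Re⟨V, π(b) w⟩ =
  -- 0` for all `b`, which is strongly continuous in `π(b)`. Approximating `T` on `V` and `w`
  -- together then contradicts `Re⟨w, T V⟩ > 0`.
  have hmem : amplification ι T V ∈ closure C₀ := by
    by_contra hn
    obtain ⟨f, s, hf, hs⟩ :=
      RCLike.geometric_hahn_banach_closed_point (𝕜 := ℂ) hconv isClosed_closure hn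
    set w := (InnerProductSpace.toDual ℂ (PiLp 2 (fun _ : ι => H))).symm f with hw
    have hfw (y) : f y = ⟪w, y⟫_ℂ := (InnerProductSpace.toDual_symm_apply).symm
    have hs0 : 0 < s := by
      have := hf 0 (subset_closure ⟨0, .zero B, by ext i; simp⟩)
      simpa using this
    have hz (b : B) (hb : IsSelfAdjoint b) : (⟪w, amplification ι (π b) V⟫_ℂ).re = 0 := by
      by_contra h0
      set r := (⟪w, amplification ι (π b) V⟫_ℂ).re
      have h1 := hf (amplification ι (π (((s / r : ℝ) : ℂ) • b)) V)
        (subset_closure ⟨_, by simp [IsSelfAdjoint, hb.star_eq], rfl⟩)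
      have h2 : amplification ι (π (((s / r : ℝ) : ℂ) • b)) V =
          ((s / r : ℝ) : ℂ) • amplification ι (π b) V := by
        ext i; simp
      rw [h2, map_smul, hfw, smul_eq_mul, RCLike.re_eq_complex_re, Complex.re_ofReal_mul,
        div_mul_cancel₀ _ h0] at h1
      exact lt_irrefl _ h1
    have hsym (S : H →L[ℂ] H) :
        (⟪w, amplification ι (star S) V⟫_ℂ).re = (⟪V, amplification ι S w⟫_ℂ).re := by
      rw [inner_amplification, star_star, ← inner_conj_symm, Complex.conj_re]
    have hb0 (b : B) :
        (⟪w, amplification ι (π b) V⟫_ℂ).re + (⟪V, amplification ι (π b) w⟫_ℂ).re = 0 := by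
      have h1 := hz (b + star b) (IsSelfAdjoint.add_star_self b)
      have h2 : amplification ι (π (b + star b)) V =
          amplification ι (π b) V + amplification ι (star (π b)) V := by
        ext i; simp [map_star]
      rw [h2, inner_add_right, Complex.add_re, hsym] at h1
      exact h1
    have hT0 : 2 * (⟪w, amplification ι T V⟫_ℂ).re =
        (⟪w, amplification ι T V⟫_ℂ).re + (⟪V, amplification ι T w⟫_ℂ).re := by
      rw [← hsym, hTs.star_eq, two_mul]
    have hpos : 0 < (⟪w, amplification ι T V⟫_ℂ).re := by
      rw [← hfw]; exact hs0.trans hs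
    set r := (⟪w, amplification ι T V⟫_ℂ).re with hr
    let δ := r / (∑ i, ‖w i‖ + ∑ i, ‖V i‖ + 1)
    have hsum : 0 < ∑ i, ‖w i‖ + ∑ i, ‖V i‖ + 1 := by positivity
    have hδ : 0 < δ := div_pos hpos hsum
    obtain ⟨b, hb⟩ := exists_near_of_mem_doubleCommutant π hπ hT (Sum.elim v w) hδ
    have hest (x y : PiLp 2 (fun _ : ι => H)) (hy : ∀ i, ‖T (y i) - π b (y i)‖ < δ) :
        (⟪x, amplification ι T y⟫_ℂ).re - (⟪x, amplification ι (π b) y⟫_ℂ).re ≤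
          (∑ i, ‖x i‖) * δ := by
      rw [← Complex.sub_re, ← inner_sub_right, PiLp.inner_apply, Complex.re_sum, Finset.sum_mul]
      refine Finset.sum_le_sum fun i _ => ?_
      refine (Complex.re_le_norm _).trans ((norm_inner_le_norm _ _).trans ?_)
      gcongr
      exact (hy i).le
    have e1 := hest w V fun i => hb (Sum.inl i)
    have e2 := hest V w fun i => hb (Sum.inr i)
    have e3 := hb0 b
    have e4 : (∑ i, ‖w i‖ + ∑ i, ‖V i‖ + 1) * δ = r := mul_div_cancel₀ _ hsum.ne'
    nlinarith
  obtain ⟨_, ⟨b, hb, rfl⟩, hd⟩ := Metric.mem_closure_iff.1 hmem ε hε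
  refine ⟨b, hb, fun i => ?_⟩
  rw [dist_eq_norm] at hd
  exact (PiLp.norm_apply_le (amplification ι T V - amplification ι (π b) V) i).trans_lt hd

/-- Solves `T = S / (1 + S²)`. The range of `s / (1 + s²)` on `ℝ` is `[-1/2, 1/2]`, which explains
the norm bound; `g` is the branch of the inverse that is continuous at 0. -/
lemma exists_cayley_preimage {T : H →L[ℂ] H} (hT : IsSelfAdjoint T) (hn : ‖T‖ ≤ 1 / 2) :
    ∃ S : H →L[ℂ] H, IsSelfAdjoint S ∧ S * S * T + T = S ∧ ∀ R, Commute T R → Commute S R := by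
  obtain ⟨g, hg, hgT⟩ : ∃ g : ℝ → ℝ, Continuous g ∧ ∀ t, |t| ≤ 1 / 2 → g t * g t * t + t = g t := by
    refine ⟨fun t => 2 * t / (1 + √(1 - 4 * t ^ 2)), ?_, fun t ht => ?_⟩
    · exact Continuous.div (by fun_prop) (by fun_prop) fun t => by positivity
    · have h1 : 0 ≤ 1 - 4 * t ^ 2 := by
        have := abs_le.1 ht
        nlinarith
      have h2 := Real.sq_sqrt h1
      have h3 := Real.sqrt_nonneg (1 - 4 * t ^ 2)
      dsimp only
      generalize √(1 - 4 * t ^ 2) = s at h2 h3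
      have h4 : 1 + s ≠ 0 := by positivity
      field_simp
      linear_combination t * h2
  refine ⟨cfc g T, IsSelfAdjoint.cfc, ?_, fun R hR => ?_⟩
  · have h1 : cfc g T * cfc g T * T + T = cfc (fun t => g t * g t * t + t) T := by
      rw [cfc_add T (fun t => g t * g t * t) (fun t => t), cfc_mul (fun t => g t * g t) (fun t => t) T,
        cfc_mul g g T, cfc_id' ℝ T]
    rw [h1]
    refine cfc_congr fun t ht => hgT t ?_
    exact (IsometricContinuousFunctionalCalculus.norm_spectrum_le T ht).trans hn
  · exact hR.cfc_real g

/-- Here `a = b / (1 + b²)`. This turns an approximant `b` of uncontrolled norm into a contraction.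
-/
lemma exists_cayley_contraction {A : Type*} [NonUnitalCStarAlgebra A] {b : A}
    (hb : IsSelfAdjoint b) :
    ∃ a : A, IsSelfAdjoint a ∧ ‖a‖ ≤ 1 ∧ ‖a * b‖ ≤ 1 ∧ a * b * b + a = b := by
  obtain ⟨f, hf, hf0, hf1, hf2, hff⟩ : ∃ f : ℝ → ℝ, Continuous f ∧ f 0 = 0 ∧ (∀ t, ‖f t‖ ≤ 1) ∧
      (∀ t, ‖f t * t‖ ≤ 1) ∧ ∀ t, f t * t * t + f t = t := by
    refine ⟨fun t => t / (1 + t ^ 2), continuous_id.div (by fun_prop) fun t => by positivity,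
      by simp, fun t => ?_, fun t => ?_, fun t => ?_⟩
    · rw [Real.norm_eq_abs, abs_div, abs_of_pos (by positivity : 0 < 1 + t ^ 2),
        div_le_one (by positivity)]
      nlinarith [sq_abs t, sq_nonneg (|t| - 1), abs_nonneg t]
    · rw [div_mul_eq_mul_div, ← sq, Real.norm_of_nonneg (by positivity),
        div_le_one (by positivity)]
      linarith
    · have : 1 + t ^ 2 ≠ 0 := by positivity
      field_simp
      ring
  have hab : cfcₙ f b * b = cfcₙ (fun t => f t * t) b := by
    rw [cfcₙ_mul f (fun t => t) b, cfcₙ_id' ℝ b]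
  refine ⟨cfcₙ f b, IsSelfAdjoint.cfcₙ, norm_cfcₙ_le fun t _ => hf1 t, ?_, ?_⟩
  · rw [hab]
    exact norm_cfcₙ_le fun t _ => hf2 t
  · have h1 : cfcₙ (fun t => f t * t * t + f t) b = cfcₙ f b * b * b + cfcₙ f b := by
      rw [cfcₙ_add (fun t => f t * t * t) f b (by fun_prop) (by simp),
        cfcₙ_mul (fun t => f t * t) (fun t => t) b (by fun_prop) (by simp), hab, cfcₙ_id' ℝ b]
    rw [← h1, funext hff, cfcₙ_id' ℝ b]

/-- A quantitative form of Kaplansky's density theorem for self-adjoint operators. -/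
lemma exists_bounded_selfAdjoint_near (π : B →⋆ₙₐ[ℂ] (H →L[ℂ] H))
    (hπ : ∀ w, (∀ b, π b w = 0) → w = 0) {T : H →L[ℂ] H}
    (hT : T ∈ Set.centralizer (Set.centralizer (Set.range π))) (hTs : IsSelfAdjoint T)
    (hn : ‖T‖ ≤ 1 / 2) (ξ : H) {ε : ℝ} (hε : 0 < ε) :
    ∃ a, IsSelfAdjoint a ∧ ‖a‖ ≤ 1 ∧ ‖T ξ - π a ξ‖ < ε := by
  obtain ⟨S, hS, hST, hcomm⟩ := exists_cayley_preimage hTs hn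
  have hSM : S ∈ Set.centralizer (Set.centralizer (Set.range π)) := fun R hR =>
    ((hcomm R (hT R hR).symm).symm : R * S = S * R)
  -- `u` is `(1 + S²)⁻¹ ξ`, so `T ξ = S u` and `ξ = u + S² u`. The identity `key` below then bounds
  -- `T ξ - π(a) ξ` by the errors of `b` at `u` and `S u` alone, multiplied by contractions.
  obtain ⟨u, hu⟩ : ∃ u, u = ξ - S (T ξ) := ⟨_, rfl⟩
  have hξ : S (S (T ξ)) + T ξ = S ξ := congrArg (fun R : H →L[ℂ] H => R ξ) hST
  have hSu : S u = T ξ := by rw [hu, map_sub, ← hξ]; abel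
  obtain ⟨b, hb, hbd⟩ := exists_selfAdjoint_near_of_mem_doubleCommutant π hπ hSM hS ![u, S u]
    (show (0 : ℝ) < ε / 3 by positivity)
  have h0 : ‖S u - π b u‖ < ε / 3 := hbd 0
  have h1 : ‖S (S u) - π b (S u)‖ < ε / 3 := hbd 1
  obtain ⟨a, ha, han, habn, habb⟩ := exists_cayley_contraction hb
  have hle (c : B) (hc : ‖c‖ ≤ 1) (y : H) : ‖π c y‖ ≤ ‖y‖ := by
    refine ((π c).le_opNorm y).trans ?_
    have := (NonUnitalStarAlgHom.norm_apply_le π c).trans hc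
    nlinarith [norm_nonneg y]
  refine ⟨a, ha, han, ?_⟩
  have hξu : ξ = u + S (S u) := by rw [hSu, hu]; abel
  have h2 : π (a * b) (π b u) + π a u = π b u := by
    conv_rhs => rw [← habb]
    simp
  have key : T ξ - π a ξ = (S u - π b u) - π a (S (S u) - π b (S u)) -
      π (a * b) (S u - π b u) := by
    rw [← hSu]
    conv_lhs => rw [hξu]
    have h3 : π (a * b) (S u) = π a (π b (S u)) := by simp
    rw [map_sub, map_sub, map_add, h3, eq_sub_of_add_eq h2]
    abel
  rw [key]
  have e1 := hle a han (S (S u) - π b (S u))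
  have e2 := hle _ habn (S u - π b u)
  have e3 := norm_sub_le ((S u - π b u) - π a (S (S u) - π b (S u))) (π (a * b) (S u - π b u))
  have e4 := norm_sub_le (S u - π b u) (π a (S (S u) - π b (S u)))
  linarith

end DoubleCommutant

/-! ### Strong-star limits of bounded sequences in the GNS representation. -/

section StrongStarLimits

set_option linter.unusedSectionVars false

variable {B : Type*} [NonUnitalCStarAlgebra B] [PartialOrder B] [StarOrderedRing B]
  {ρ : B →ₚ[ℂ] ℂ} {F : Filter ℕ}

lemma gns_nondegenerate (ρ : B →ₚ[ℂ] ℂ) (w : ρ.GNS)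
    (hw : ∀ b, ρ.gnsNonUnitalStarAlgHom b w = 0) : w = 0 := by
  refine gns_ext fun a => ?_
  rw [inner_zero_right, ← gns_apply_gnsVector, ← ContinuousLinearMap.adjoint_inner_right,
    ← ContinuousLinearMap.star_eq_adjoint, ← map_star, hw, inner_zero_right]

lemma mem_gnsVN_iff {T : ρ.GNS →L[ℂ] ρ.GNS} :
    T ∈ gnsVN ρ ↔ T ∈ Set.centralizer (Set.centralizer (Set.range ρ.gnsNonUnitalStarAlgHom)) := by
  rw [← coe_gnsVN, SetLike.mem_coe]

/-- Every element of the von Neumann algebra is approximated, together with its adjoint, by a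
bounded set of elements of `B` on the cyclic vector. -/
lemma exists_bounded_near_of_mem_gnsVN {T : ρ.GNS →L[ℂ] ρ.GNS} (hT : T ∈ gnsVN ρ) :
    ∃ C : ℝ, ∀ ε : ℝ, 0 < ε → ∃ a : B, ‖a‖ ≤ C ∧
      ‖T (gnsVector ρ) - ρ.gnsNonUnitalStarAlgHom a (gnsVector ρ)‖ < ε ∧
      ‖star T (gnsVector ρ) - star (ρ.gnsNonUnitalStarAlgHom a) (gnsVector ρ)‖ < ε := by
  set ξ := gnsVector ρ
  set π := ρ.gnsNonUnitalStarAlgHom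
  have hsa (R : ρ.GNS →L[ℂ] ρ.GNS) (hR : R ∈ gnsVN ρ) (hRs : IsSelfAdjoint R) :
      ∃ C : ℝ, ∀ ε : ℝ, 0 < ε → ∃ a : B, IsSelfAdjoint a ∧ ‖a‖ ≤ C ∧ ‖R ξ - π a ξ‖ < ε := by
    -- Scales `R` into the ball of radius `1/2`; the resulting bound depends on `R` only and not on
    -- `ε`.
    let r : ℝ := 2 * ‖R‖ + 1
    have hr : 0 < r := by positivity
    have hn : ‖((r⁻¹ : ℝ) : ℂ) • R‖ ≤ 1 / 2 := by
      rw [norm_smul, Complex.norm_real, Real.norm_of_nonneg (by positivity), inv_mul_le_iff₀ hr]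
      simp only [r]
      linarith
    refine ⟨r, fun ε hε => ?_⟩
    obtain ⟨a, ha, han, had⟩ := exists_bounded_selfAdjoint_near π (gns_nondegenerate ρ)
      (mem_gnsVN_iff.1 ((gnsVN ρ).smul_mem hR ((r⁻¹ : ℝ) : ℂ)))
      (by simp [IsSelfAdjoint, hRs.star_eq]) hn ξ (div_pos hε hr)
    refine ⟨(r : ℂ) • a, by simp [IsSelfAdjoint, ha.star_eq], ?_, ?_⟩
    · rw [norm_smul, Complex.norm_real, Real.norm_of_nonneg hr.le]
      nlinarith
    · have h1 : R ξ - π ((r : ℂ) • a) ξ = (r : ℂ) • ((((r⁻¹ : ℝ) : ℂ) • R) ξ - π a ξ) := by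
        rw [map_smul, smul_sub, smul_apply, smul_apply, smul_smul, ← Complex.ofReal_mul,
          mul_inv_cancel₀ hr.ne', Complex.ofReal_one, one_smul]
      rw [h1, norm_smul, Complex.norm_real, Real.norm_of_nonneg hr.le, mul_comm]
      exact (lt_div_iff₀ hr).1 had
  have hTs := star_mem hT
  -- `2T` and `2T*` are `(T + T*) ∓ i · i(T - T*)`, so self-adjoint approximants of the two parts
  -- serve `T` and its adjoint at once.
  obtain ⟨C₁, h₁⟩ := hsa (T + star T) (add_mem hT hTs) (IsSelfAdjoint.add_star_self T)
  obtain ⟨C₂, h₂⟩ := hsa (Complex.I • (T - star T)) ((gnsVN ρ).smul_mem (sub_mem hT hTs) _) (by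
    simp [IsSelfAdjoint, ← smul_neg])
  refine ⟨C₁ + C₂, fun ε hε => ?_⟩
  obtain ⟨a, ha, han, had⟩ := h₁ ε hε
  obtain ⟨b, hb, hbn, hbd⟩ := h₂ ε hε
  refine ⟨(1 / 2 : ℂ) • (a - Complex.I • b), ?_, ?_, ?_⟩
  · have := norm_sub_le a (Complex.I • b)
    rw [norm_smul, Complex.norm_I, one_mul] at this
    rw [norm_smul]
    norm_num
    linarith [norm_nonneg (a - Complex.I • b)]
  · have e1 : T ξ - π ((1 / 2 : ℂ) • (a - Complex.I • b)) ξ = (1 / 2 : ℂ) • (((T + star T) ξ - π a ξ)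
        - Complex.I • ((Complex.I • (T - star T)) ξ - π b ξ)) := by
      simp only [map_smul, map_sub, smul_apply, sub_apply, add_apply, smul_sub, smul_smul,
        smul_add]
      rw [← mul_assoc, mul_assoc _ Complex.I Complex.I, Complex.I_mul_I]
      module
    rw [e1, norm_smul]
    have := norm_sub_le ((T + star T) ξ - π a ξ) (Complex.I • ((Complex.I • (T - star T)) ξ - π b ξ))
    rw [norm_smul, Complex.norm_I, one_mul] at this
    norm_num at *
    linarith
  · have e1 : star T ξ - star (π ((1 / 2 : ℂ) • (a - Complex.I • b))) ξ =
        (1 / 2 : ℂ) • (((T + star T) ξ - π a ξ)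
        + Complex.I • ((Complex.I • (T - star T)) ξ - π b ξ)) := by
      have e2 : star ((1 / 2 : ℂ) • (a - Complex.I • b)) = (1 / 2 : ℂ) • (a + Complex.I • b) := by
        rw [star_smul, star_sub, star_smul, ha.star_eq, hb.star_eq]
        simp
      rw [← map_star, e2]
      simp only [map_smul, map_add, smul_apply, sub_apply, add_apply, smul_sub, smul_smul,
        smul_add]
      rw [← mul_assoc, mul_assoc _ Complex.I Complex.I, Complex.I_mul_I]
      module
    rw [e1, norm_smul]
    have := norm_add_le ((T + star T) ξ - π a ξ) (Complex.I • ((Complex.I • (T - star T)) ξ - π b ξ))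
    rw [norm_smul, Complex.norm_I, one_mul] at this
    norm_num at *
    linarith

/-- The operator `T` is the limit of `π_ρ(x_n)` along `F` in the strong-star topology. -/
def IsStrongStarLimit (ρ : B →ₚ[ℂ] ℂ) (F : Filter ℕ) (x : BoundedSeq B)
    (T : ρ.GNS →L[ℂ] ρ.GNS) : Prop :=
  ∀ η : ρ.GNS, Tendsto (fun n => ρ.gnsNonUnitalStarAlgHom (x n) η) F (𝓝 (T η)) ∧
    Tendsto (fun n => star (ρ.gnsNonUnitalStarAlgHom (x n)) η) F (𝓝 (star T η))

namespace IsStrongStarLimit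

variable {x y : BoundedSeq B} {S T : ρ.GNS →L[ℂ] ρ.GNS}

lemma unique [F.NeBot] (hS : IsStrongStarLimit ρ F x S) (hT : IsStrongStarLimit ρ F x T) :
    S = T := by
  ext η
  exact tendsto_nhds_unique (hS η).1 (hT η).1

lemma add (hS : IsStrongStarLimit ρ F x S) (hT : IsStrongStarLimit ρ F y T) :
    IsStrongStarLimit ρ F (x + y) (S + T) := by
  intro η
  refine ⟨((hS η).1.add (hT η).1).congr fun n => ?_, ?_⟩
  · simp
  · rw [star_add]
    refine ((hS η).2.add (hT η).2).congr fun n => ?_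
    simp [star_add]

lemma smul (c : ℂ) (hS : IsStrongStarLimit ρ F x S) : IsStrongStarLimit ρ F (c • x) (c • S) := by
  intro η
  refine ⟨((hS η).1.const_smul c).congr fun n => ?_, ?_⟩
  · simp
  · rw [star_smul]
    refine ((hS η).2.const_smul (star c)).congr fun n => ?_
    simp [star_smul]

lemma star (hS : IsStrongStarLimit ρ F x S) : IsStrongStarLimit ρ F (star x) (star S) := by
  intro η
  refine ⟨(hS η).2.congr fun n => ?_, ?_⟩
  · rw [← map_star]; rfl
  · rw [star_star]
    refine (hS η).1.congr fun n => ?_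
    rw [← map_star, lp.star_apply, star_star]

/-- Multiplication is jointly strongly continuous on bounded sets: split `x_n y_n η` as `x_n (y_n η
- T η) + x_n T η`. -/
lemma tendsto_mul (hS : ∀ η, Tendsto (fun n => ρ.gnsNonUnitalStarAlgHom (x n) η) F (𝓝 (S η)))
    (hT : ∀ η, Tendsto (fun n => ρ.gnsNonUnitalStarAlgHom (y n) η) F (𝓝 (T η))) (η : ρ.GNS) :
    Tendsto (fun n => ρ.gnsNonUnitalStarAlgHom ((x * y) n) η) F (𝓝 ((S * T) η)) := by
  have h1 : Tendsto (fun n => ‖x‖ * ‖ρ.gnsNonUnitalStarAlgHom (y n) η - T η‖) F (𝓝 0) := by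
    simpa using ((hT η).sub_const (T η)).norm.const_mul ‖x‖
  have h2 : Tendsto (fun n => ρ.gnsNonUnitalStarAlgHom (x n)
      (ρ.gnsNonUnitalStarAlgHom (y n) η - T η)) F (𝓝 0) := by
    refine squeeze_zero_norm (fun n => ?_) h1
    refine (norm_gns_apply_le ρ _ _).trans ?_
    gcongr
    exact boundedSeq_norm_le x n
  have h3 := h2.add (hS (T η))
  rw [zero_add] at h3
  refine h3.congr fun n => ?_
  rw [map_sub (ρ.gnsNonUnitalStarAlgHom (x n)), sub_add_cancel]
  simp

lemma mul (hS : IsStrongStarLimit ρ F x S) (hT : IsStrongStarLimit ρ F y T) :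
    IsStrongStarLimit ρ F (x * y) (S * T) := by
  intro η
  refine ⟨tendsto_mul (fun η => (hS η).1) (fun η => (hT η).1) η, ?_⟩
  have h := tendsto_mul (fun η => (hT.star η).1) (fun η => (hS.star η).1) η
  rw [star_mul]
  refine h.congr fun n => ?_
  rw [← star_mul, lp.star_apply, map_star]

lemma congr (hS : IsStrongStarLimit ρ F x S) (h : SeqAlg.mk F x = SeqAlg.mk F y) :
    IsStrongStarLimit ρ F y S := by
  have hnull := SeqAlg.mk_eq_mk.1 h.symm
  have key (z : BoundedSeq B) (hz : z ∈ nullSeq B F) (η : ρ.GNS) :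
      Tendsto (fun n => ρ.gnsNonUnitalStarAlgHom (z n) η) F (𝓝 0) := by
    have h1 : Tendsto (fun n => ‖z n‖ * ‖η‖) F (𝓝 0) := by
      simpa using (mem_nullSeq.1 hz).mul_const ‖η‖
    exact squeeze_zero_norm (fun n => norm_gns_apply_le ρ _ _) h1
  have h0 : IsStrongStarLimit ρ F (y - x) 0 := by
    intro η
    refine ⟨by simpa using key _ hnull η, ?_⟩
    rw [star_zero]
    refine (key _ (nullSeq_star hnull) η).congr fun n => ?_
    rw [← map_star]; rfl
  simpa using hS.add h0

/-- A strong-star limit vanishes iff the sequence is null in the `(ρ,#)`-norm. -/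
lemma eq_zero_iff [F.NeBot] (hρ : IsStronglyFaithful ρ) (hT : T ∈ gnsVN ρ)
    (h : IsStrongStarLimit ρ F x T) : T = 0 ↔ IsRhoSharpNull ρ F x := by
  have h1 := ((h (gnsVector ρ)).1).norm
  have h2 := ((h (gnsVector ρ)).2).norm
  simp only [← map_star, norm_gns_gnsVector] at h1 h2
  constructor
  · rintro rfl
    have h3 := (h1.add h2).const_mul (1 / 2)
    simp only [star_zero, zero_apply, norm_zero, add_zero, mul_zero] at h3
    exact h3
  · intro hx
    refine hρ.faithful_ext T hT ?_
    have h3 : Tendsto (fun n => rhoNorm ρ (x n)) F (𝓝 0) := by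
      have h4 : Tendsto (fun n => 2 * rhoSharpNorm ρ (x n)) F (𝓝 0) := by
        simpa using Tendsto.const_mul 2 hx
      refine squeeze_zero (fun n => rhoNorm_nonneg ρ _) (fun n => ?_) h4
      have := rhoNorm_nonneg ρ (Star.star (x n))
      unfold rhoSharpNorm
      linarith
    have h5 : T (gnsVector ρ) = 0 := norm_eq_zero.1 (tendsto_nhds_unique h1 h3)
    rw [gnsExt, mul_apply_eq_comp, h5, map_zero, inner_zero_right]

end IsStrongStarLimit

/-- By `tendsto_gns` the sequence is Cauchy at every vector, and the pointwise limit is an operator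
of norm at most `‖x‖`. -/
lemma IsStronglyFaithful.exists_limit [F.NeBot] (hρ : IsStronglyFaithful ρ) {x : BoundedSeq B}
    (hx : Tendsto (fun p : ℕ × ℕ => rhoNorm ρ (x p.1 - x p.2)) (F ×ˢ F) (𝓝 0)) :
    ∃ T : ρ.GNS →L[ℂ] ρ.GNS, ∀ η, Tendsto (fun n => ρ.gnsNonUnitalStarAlgHom (x n) η) F (𝓝 (T η)) := by
  have hex (η : ρ.GNS) :
      ∃ v, Tendsto (fun n => ρ.gnsNonUnitalStarAlgHom (x n) η) F (𝓝 v) := by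
    refine cauchy_map_iff_exists_tendsto.1 (cauchy_map_iff.2 ⟨‹_›, ?_⟩)
    rw [Metric.uniformity_eq_comap_nhds_zero, tendsto_comap_iff]
    refine (hρ.tendsto_gns hx η).congr fun p => ?_
    simp only [Function.comp_apply, dist_eq_norm]
    rw [map_sub, sub_apply]
  choose f hf using hex
  let g := linearMapOfTendsto (l := F) f
    (fun n => (ρ.gnsNonUnitalStarAlgHom (x n) : ρ.GNS →ₗ[ℂ] ρ.GNS)) (tendsto_pi_nhds.2 hf)
  refine ⟨g.mkContinuous ‖x‖ fun η => ?_, hf⟩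
  refine le_of_tendsto (hf η).norm (.of_forall fun n => ?_)
  refine (norm_gns_apply_le ρ _ _).trans ?_
  gcongr
  exact boundedSeq_norm_le x n

/-- A `(ρ,#)`-Cauchy bounded sequence has a strong-star limit in the von Neumann algebra. -/
lemma IsStronglyFaithful.exists_strongStarLimit [F.NeBot] (hρ : IsStronglyFaithful ρ)
    {x : BoundedSeq B} (hx : IsRhoSharpCauchy ρ F x) :
    ∃ T ∈ gnsVN ρ, IsStrongStarLimit ρ F x T := by
  obtain ⟨h1, h2⟩ := isRhoSharpCauchy_iff.1 hx
  obtain ⟨T, hT⟩ := hρ.exists_limit h1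
  obtain ⟨T', hT'⟩ := hρ.exists_limit h2
  -- The limits of `x_n` and `x_n*` exist separately; passing to the limit in inner products shows
  -- that they are adjoint.
  have hadj : T' = star T := by
    rw [ContinuousLinearMap.star_eq_adjoint, ContinuousLinearMap.eq_adjoint_iff]
    intro u v
    have e1 := (hT' u).inner (tendsto_const_nhds (x := v)) (𝕜 := ℂ)
    have e2 := (tendsto_const_nhds (x := u)).inner (hT v) (𝕜 := ℂ)
    refine tendsto_nhds_unique e1 (e2.congr fun n => ?_)
    rw [lp.star_apply, map_star, ContinuousLinearMap.star_eq_adjoint,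
      ContinuousLinearMap.adjoint_inner_left]
  refine ⟨T, mem_gnsVN_iff.2 fun R hR => ?_, fun η => ⟨hT η, ?_⟩⟩
  · ext η
    have e1 := (R.continuous.tendsto _).comp (hT η)
    refine tendsto_nhds_unique e1 ((hT (R η)).congr fun n => ?_)
    exact congrArg (fun S : ρ.GNS →L[ℂ] ρ.GNS => S η) (hR _ ⟨x n, rfl⟩)
  · rw [← hadj]
    refine (hT' η).congr fun n => ?_
    rw [lp.star_apply, map_star]

/-- Every element of the von Neumann algebra is the strong-star limit of a bounded sequence. -/
lemma IsStronglyFaithful.exists_boundedSeq [F.NeBot] (hF : F ≤ atTop) (hρ : IsStronglyFaithful ρ)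
    {T : ρ.GNS →L[ℂ] ρ.GNS} (hT : T ∈ gnsVN ρ) :
    ∃ x : BoundedSeq B, IsRhoSharpCauchy ρ F x ∧ IsStrongStarLimit ρ F x T := by
  obtain ⟨C, hC⟩ := exists_bounded_near_of_mem_gnsVN hT
  have hpos (n : ℕ) : (0 : ℝ) < 1 / ((n : ℝ) + 1) := by positivity
  choose f hfC hf hf' using fun n : ℕ => hC (1 / ((n : ℝ) + 1)) (hpos n)
  let x : BoundedSeq B := ⟨f, memℓp_infty ⟨C, by rintro _ ⟨n, rfl⟩; exact hfC n⟩⟩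
  have h0 : Tendsto (fun n : ℕ => 1 / ((n : ℝ) + 1)) F (𝓝 0) :=
    tendsto_one_div_add_atTop_nhds_zero_nat.mono_left hF
  have hcauchy (z : BoundedSeq B) (v : ρ.GNS)
      (hz : Tendsto (fun n => ρ.gnsNonUnitalStarAlgHom (z n) (gnsVector ρ)) F (𝓝 v)) :
      Tendsto (fun p : ℕ × ℕ => rhoNorm ρ (z p.1 - z p.2)) (F ×ˢ F) (𝓝 0) := by
    have h1 := ((hz.comp (tendsto_fst (f := F) (g := F))).sub
      (hz.comp (tendsto_snd (f := F) (g := F)))).norm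
    rw [sub_self, norm_zero] at h1
    refine h1.congr fun p => ?_
    rw [← norm_gns_gnsVector, map_sub, sub_apply]
    rfl
  have ht1 : Tendsto (fun n => ρ.gnsNonUnitalStarAlgHom (x n) (gnsVector ρ)) F
      (𝓝 (T (gnsVector ρ))) := by
    rw [tendsto_iff_norm_sub_tendsto_zero]
    refine squeeze_zero (fun n => norm_nonneg _) (fun n => ?_) h0
    rw [norm_sub_rev]
    exact (hf n).le
  have ht2 : Tendsto (fun n => ρ.gnsNonUnitalStarAlgHom ((star x) n) (gnsVector ρ)) F
      (𝓝 (star T (gnsVector ρ))) := by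
    rw [tendsto_iff_norm_sub_tendsto_zero]
    refine squeeze_zero (fun n => norm_nonneg _) (fun n => ?_) h0
    rw [norm_sub_rev, lp.star_apply, map_star]
    exact (hf' n).le
  have hx : IsRhoSharpCauchy ρ F x :=
    isRhoSharpCauchy_iff.2 ⟨hcauchy _ _ ht1, hcauchy _ _ ht2⟩
  obtain ⟨S, hS, hSx⟩ := hρ.exists_strongStarLimit hx
  -- The approximants only control `T` at `ξ_ρ`, which suffices because `ξ_ρ` separates the von
  -- Neumann algebra.
  have hST : S - T = 0 := by
    refine hρ.faithful_ext _ (sub_mem hS hT) ?_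
    have h5 : (S - T) (gnsVector ρ) = 0 := by
      rw [sub_apply, tendsto_nhds_unique (hSx _).1 ht1, sub_self]
    rw [gnsExt, mul_apply_eq_comp, h5, map_zero, inner_zero_right]
  exact ⟨x, hx, sub_eq_zero.1 hST ▸ hSx⟩

end StrongStarLimits

/-! ### The extension and its pure largeness. -/

section StateKernelExtension

variable {B : Type*} [NonUnitalCStarAlgebra B] [PartialOrder B] [StarOrderedRing B]
  {ρ : B →ₚ[ℂ] ℂ} {F : Filter ℕ} [F.NeBot]

lemma exists_cauchyAlg_limit (hρ : IsStronglyFaithful ρ) (a : cauchyAlg ρ hρ F) :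
    ∃ T : (gnsVN ρ).toStarSubalgebra, ∀ x : BoundedSeq B, SeqAlg.mk F x = a →
      IsStrongStarLimit ρ F x T := by
  obtain ⟨_, x, rfl, hx⟩ := a
  obtain ⟨T, hT, hxT⟩ := hρ.exists_strongStarLimit hx
  exact ⟨⟨T, hT⟩, fun y hy => hxT.congr hy.symm⟩

/-- The quotient map of the reduced state-kernel extension, on elements. -/
noncomputable def cauchyAlgLimit (hρ : IsStronglyFaithful ρ) (a : cauchyAlg ρ hρ F) :
    (gnsVN ρ).toStarSubalgebra := (exists_cauchyAlg_limit hρ a).choose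

lemma cauchyAlgLimit_spec (hρ : IsStronglyFaithful ρ) {a : cauchyAlg ρ hρ F} {x : BoundedSeq B}
    (hx : SeqAlg.mk F x = a) :
    IsStrongStarLimit ρ F x (cauchyAlgLimit hρ a : ρ.GNS →L[ℂ] ρ.GNS) :=
  (exists_cauchyAlg_limit hρ a).choose_spec x hx

lemma cauchyAlgLimit_eq (hρ : IsStronglyFaithful ρ) {a : cauchyAlg ρ hρ F} {x : BoundedSeq B}
    (hx : SeqAlg.mk F x = a) {T : (gnsVN ρ).toStarSubalgebra}
    (hT : IsStrongStarLimit ρ F x (T : ρ.GNS →L[ℂ] ρ.GNS)) : cauchyAlgLimit hρ a = T :=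
  Subtype.ext ((cauchyAlgLimit_spec hρ hx).unique hT)

/-- The quotient map of the reduced state-kernel extension: it sends the class of a
`(ρ,#)`-Cauchy sequence to its strong-star limit. -/
noncomputable def cauchyAlgHom (hρ : IsStronglyFaithful ρ) (F : Filter ℕ) [F.NeBot] :
    cauchyAlg ρ hρ F →⋆ₙₐ[ℂ] (gnsVN ρ).toStarSubalgebra where
  toFun := cauchyAlgLimit hρ
  map_smul' c a := by
    obtain ⟨x, hx⟩ := SeqAlg.mk_surjective (a : SeqAlg B F)
    refine cauchyAlgLimit_eq hρ (x := c • x) ?_ ((cauchyAlgLimit_spec hρ hx).smul c)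
    rw [SeqAlg.mk_smul, hx]; rfl
  map_zero' := by
    refine cauchyAlgLimit_eq hρ (x := 0) rfl fun η => ?_
    have h0 : ((0 : (gnsVN ρ).toStarSubalgebra) : ρ.GNS →L[ℂ] ρ.GNS) = 0 := rfl
    rw [h0]
    simp
  map_add' a b := by
    obtain ⟨x, hx⟩ := SeqAlg.mk_surjective (a : SeqAlg B F)
    obtain ⟨y, hy⟩ := SeqAlg.mk_surjective (b : SeqAlg B F)
    refine cauchyAlgLimit_eq hρ (x := x + y) ?_
      ((cauchyAlgLimit_spec hρ hx).add (cauchyAlgLimit_spec hρ hy))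
    rw [SeqAlg.mk_add, hx, hy]; rfl
  map_mul' a b := by
    obtain ⟨x, hx⟩ := SeqAlg.mk_surjective (a : SeqAlg B F)
    obtain ⟨y, hy⟩ := SeqAlg.mk_surjective (b : SeqAlg B F)
    refine cauchyAlgLimit_eq hρ (x := x * y) ?_
      ((cauchyAlgLimit_spec hρ hx).mul (cauchyAlgLimit_spec hρ hy))
    rw [SeqAlg.mk_mul, hx, hy]; rfl
  map_star' a := by
    obtain ⟨x, hx⟩ := SeqAlg.mk_surjective (a : SeqAlg B F)
    refine cauchyAlgLimit_eq hρ (x := star x) ?_ (cauchyAlgLimit_spec hρ hx).star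
    rw [SeqAlg.mk_star, hx]; rfl

lemma stateKernel_le_cauchyAlg (hρ : IsStronglyFaithful ρ) (F : Filter ℕ) [F.NeBot] :
    stateKernel ρ F ≤ cauchyAlg ρ hρ F := by
  rintro _ ⟨x, rfl, hx⟩
  exact ⟨x, rfl, hx.isRhoSharpCauchy⟩

lemma cauchyAlgHom_eq_zero_iff (hρ : IsStronglyFaithful ρ) (a : cauchyAlg ρ hρ F) :
    cauchyAlgHom hρ F a = 0 ↔ (a : SeqAlg B F) ∈ stateKernel ρ F := by
  obtain ⟨x, hx⟩ := SeqAlg.mk_surjective (a : SeqAlg B F)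
  rw [← hx, mk_mem_stateKernel,
    ← (cauchyAlgLimit_spec hρ hx).eq_zero_iff hρ (cauchyAlgLimit hρ a).2]
  exact Subtype.ext_iff

/-- The reduced state-kernel extension along `F`. -/
noncomputable def stateKernelExtension (hρ : IsStronglyFaithful ρ) (hF : F ≤ atTop) :
    CStarExtension (stateKernel ρ F) (cauchyAlg ρ hρ F) (gnsVN ρ).toStarSubalgebra where
  j := NonUnitalStarSubalgebra.inclusion (stateKernel_le_cauchyAlg hρ F)
  q := cauchyAlgHom hρ F
  j_injective a b h := Subtype.ext (congrArg (fun c : cauchyAlg ρ hρ F => (c : SeqAlg B F)) h)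
  exact a := by
    rw [cauchyAlgHom_eq_zero_iff]
    constructor
    · exact fun h => ⟨⟨a, h⟩, rfl⟩
    · rintro ⟨b, rfl⟩
      exact b.2
  q_surjective T := by
    obtain ⟨x, hx, hxT⟩ := hρ.exists_boundedSeq hF T.2
    exact ⟨⟨SeqAlg.mk F x, mk_mem_cauchyAlg.2 hx⟩, cauchyAlgLimit_eq hρ rfl hxT⟩

lemma isReducedStateKernelExtension_stateKernelExtension (hρ : IsStronglyFaithful ρ)
    (hF : F ≤ atTop) : IsReducedStateKernelExtension ρ hρ F (stateKernelExtension hρ hF) :=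
  ⟨fun _ => rfl, fun _ _ η => cauchyAlgLimit_spec hρ rfl η⟩

/-- A sequence with a nonzero strong limit is eventually bounded below in norm. -/
lemma IsStrongStarLimit.eventually_le_norm {F : Filter ℕ} {x : BoundedSeq B} {T : ρ.GNS →L[ℂ] ρ.GNS}
    (h : IsStrongStarLimit ρ F x T) (hT : T ≠ 0) :
    ∃ δ : ℝ, 0 < δ ∧ ∀ᶠ n in F, δ ≤ ‖x n‖ := by
  obtain ⟨η, hη⟩ : ∃ η, T η ≠ 0 := by
    by_contra! h0
    exact hT (ContinuousLinearMap.ext h0)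
  have hTη := norm_pos_iff.2 hη
  have hη0 : 0 < ‖η‖ := norm_pos_iff.2 fun h0 => hη (by rw [h0, map_zero])
  refine ⟨‖T η‖ / 2 / ‖η‖, by positivity, ?_⟩
  filter_upwards [(h η).1.norm.eventually (lt_mem_nhds (half_lt_self hTη))] with n hn
  rw [div_le_iff₀ hη0]
  exact hn.le.trans (norm_gns_apply_le ρ _ _)

/-- The state-kernel extension of a simple purely infinite C⋆-algebra is purely large. -/
lemma isPurelyLarge_stateKernelExtension (hs : IsSimpleCStar B) (hpi : IsPurelyInfinite B)
    (hρ : IsStronglyFaithful ρ) (hF : F ≤ atTop) :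
    (stateKernelExtension hρ hF).IsPurelyLarge := by
  rintro y ⟨w', rfl⟩ x ⟨z', rfl⟩ hx ε hε
  obtain ⟨_, w, rfl, hw⟩ := w'
  obtain ⟨_, z, rfl, hz⟩ := z'
  have hlim := cauchyAlgLimit_spec hρ (a := ⟨SeqAlg.mk F z, z, rfl, hz⟩) (x := z) rfl
  have hlim' := hlim.star.mul hlim
  have hne : star (cauchyAlgLimit hρ ⟨SeqAlg.mk F z, z, rfl, hz⟩ : ρ.GNS →L[ℂ] ρ.GNS) *
      (cauchyAlgLimit hρ ⟨SeqAlg.mk F z, z, rfl, hz⟩ : ρ.GNS →L[ℂ] ρ.GNS) ≠ 0 := by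
    intro h0
    refine hx (((stateKernelExtension hρ hF).exact _).1 ?_)
    rw [map_mul, map_star]
    exact Subtype.ext h0
  -- The limit of `z_n* z_n` is nonzero because `z* z` lies outside the kernel.
  obtain ⟨δ, hδ, hev⟩ := hlim'.eventually_le_norm hne
  have hpos (n : ℕ) : (0 : ℝ) < 1 / ((n : ℝ) + 1) := by positivity
  have hstep (n : ℕ) : ∃ c : B, ‖c‖ ≤ √(4 / δ) * ‖w n‖ ∧
      rhoNorm ρ c ≤ √(4 / δ) * rhoNorm ρ (w n) ∧ rhoNorm ρ (star c) ≤ 1 / ((n : ℝ) + 1) ∧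
      (δ ≤ ‖(star z * z) n‖ →
        ‖star (w n) * w n - star c * (star z * z) n * c‖ ≤ 1 / ((n : ℝ) + 1)) := by
    by_cases hn : δ ≤ ‖(star z * z) n‖
    · obtain ⟨c, h1, h2, h3, h4⟩ := exists_controlled_cuntz hs hpi ρ
        (star_mul_self_nonneg (z n)) (w n) hδ hn (hpos n)
      exact ⟨c, h2, h3, h4, fun _ => h1⟩
    -- The indices with `‖x_n‖ < δ` are negligible along `F`, so any value respecting the bounds
    -- will do.
    · refine ⟨0, by simp; positivity, ?_, ?_, fun h => absurd h hn⟩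
      · rw [rhoNorm_zero]
        exact mul_nonneg (Real.sqrt_nonneg _) (rhoNorm_nonneg ρ _)
      · rw [star_zero, rhoNorm_zero]
        exact (hpos n).le
  choose f hf1 hf2 hf3 hf4 using hstep
  have hfb (n : ℕ) : ‖f n‖ ≤ √(4 / δ) * ‖w‖ :=
    (hf1 n).trans (by gcongr; exact boundedSeq_norm_le w n)
  let c : BoundedSeq B := ⟨f, memℓp_infty ⟨_, by rintro _ ⟨n, rfl⟩; exact hfb n⟩⟩
  have h0 : Tendsto (fun n : ℕ => 1 / ((n : ℝ) + 1)) F (𝓝 0) :=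
    tendsto_one_div_add_atTop_nhds_zero_nat.mono_left hF
  have hc : IsRhoSharpNull ρ F c := by
    have h1 : Tendsto (fun n => √(4 / δ) * (2 * rhoSharpNorm ρ (w n)) + 1 / ((n : ℝ) + 1)) F
        (𝓝 0) := by
      simpa using ((Tendsto.const_mul 2 hw).const_mul √(4 / δ)).add h0
    refine squeeze_zero (fun n => rhoSharpNorm_nonneg ρ _) (fun n => ?_) h1
    have h2 : rhoNorm ρ (w n) ≤ 2 * rhoSharpNorm ρ (w n) := by
      have := rhoNorm_nonneg ρ (star (w n))
      unfold rhoSharpNorm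
      linarith
    have h3 := mul_le_mul_of_nonneg_left h2 (Real.sqrt_nonneg (4 / δ))
    have h4 := hf2 n
    have h5 := hf3 n
    have h6 := rhoNorm_nonneg ρ (f n)
    have h7 := rhoNorm_nonneg ρ (star (f n))
    change (1 / 2) * (rhoNorm ρ (f n) + rhoNorm ρ (star (f n))) ≤ _
    linarith
  refine ⟨⟨SeqAlg.mk F c, c, rfl, hc.isRhoSharpCauchy⟩, ?_⟩
  -- The error `1/(n+1)` disappears in the quotient, so a single `c` works for every `ε`.
  have hzero : SeqAlg.mk F (star w * w) = SeqAlg.mk F (star c * (star z * z) * c) := by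
    refine SeqAlg.mk_eq_mk.2 (mem_nullSeq.2 ?_)
    refine squeeze_zero' (.of_forall fun n => norm_nonneg _) ?_ h0
    filter_upwards [hev] with n hn
    exact hf4 n hn
  rw [map_mul, map_star]
  refine lt_of_eq_of_lt ?_ hε
  rw [norm_eq_zero, sub_eq_zero]
  exact Subtype.ext hzero

end StateKernelExtension

theorem mainTheorem11 {B : Type*} [NonUnitalCStarAlgebra B] [PartialOrder B] [StarOrderedRing B]
    (hsimple : IsSimpleCStar B) (hpi : IsPurelyInfinite B)
    (ρ : B →ₚ[ℂ] ℂ) (hstate : IsState ρ) (hρ : IsStronglyFaithful ρ) :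
    (∃ e : CStarExtension (stateKernel ρ atTop) (cauchyAlg ρ hρ atTop)
        (gnsVN ρ).toStarSubalgebra,
      IsReducedStateKernelExtension ρ hρ atTop e ∧ e.IsPurelyLarge) ∧
    ∀ ω : Ultrafilter ℕ, (ω : Filter ℕ) ≤ cofinite →
      ∃ e : CStarExtension (stateKernel ρ (ω : Filter ℕ)) (cauchyAlg ρ hρ (ω : Filter ℕ))
          (gnsVN ρ).toStarSubalgebra,
        IsReducedStateKernelExtension ρ hρ (ω : Filter ℕ) e ∧ e.IsPurelyLarge := by
  have key (F : Filter ℕ) [F.NeBot] (hF : F ≤ atTop) :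
      ∃ e : CStarExtension (stateKernel ρ F) (cauchyAlg ρ hρ F) (gnsVN ρ).toStarSubalgebra,
        IsReducedStateKernelExtension ρ hρ F e ∧ e.IsPurelyLarge :=
    ⟨stateKernelExtension hρ hF, isReducedStateKernelExtension_stateKernelExtension hρ hF,
      isPurelyLarge_stateKernelExtension hsimple hpi hρ hF⟩
  -- Freeness of `ω` is exactly `ω ≤ atTop`, since the cofinite filter on `ℕ` is `atTop`.
  exact ⟨key atTop le_rfl, fun ω hω => key ω (Nat.cofinite_eq_atTop ▸ hω)⟩
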